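/- Let $k_1,\dots,k_d\ge 1$, $k=\sum_i k_i$, and write $x=(x^1,\dots,x^d)\in\mathbb R^k=\mathbb R^{k_1}\times\cdots\times\mathbb R^{k_d}$, with $|\cdot|$ the Euclidean norm. Let $\psi:\mathbb R^k\to\mathbb R$ be convex with $\int_{\mathbb R^k} e^{-\psi(x)}\,dx=1$, put $\rho(dx)=e^{-\psi(x)}dx$, and assume that for some $c>0$ and $p\ge1$, $|\psi(x)|\le c(1+|x|^p)$ for almost every $x$. Let $H(\mu)=H(\mu\,\|\,\rho)\in[0,\infty]$ denote relative entropy with respect to $\rho$, and let $\mathbb W_2$ be the quadratic Wasserstein distance, $\mathbb W_2^2(\mu,\nu)=\inf_\pi\int|x-y|^2\,\pi(dx,dy)$, the infimum being over couplings $\pi$ of $\mu$ and $\nu$. Let $\mu_0=\mu_0^1\otimes\cdots\otimes\mu_0^d$ be a product probability measure with finite $p$-th moment, and let $\mu_n=\mu_n^1\otimes\cdots\otimes\mu_n^d$ be the iterates of sequential coordinate ascent variational inference (CAVI), defined for $n\ge0$ and, successively, $i=1,\dots,d$ by the probability densities $$\mu_{n+1}^i(x^i)\;\propto\;\exp\Big(-\int\psi(x^1,\dots,x^d)\,\bigotimes_{j<i}\mu_{n+1}^j(dx^j)\bigotimes_{j>i}\mu_n^j(dx^j)\Big).$$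 Let $\mu_*$ be a minimizer of $H$ over all product probability measures $\nu^1\otimes\cdots\otimes\nu^d$ with $\nu^i$ a probability measure on $\mathbb R^{k_i}$, and set $R=\sup_{n\ge1}\mathbb W_2(\mu_n,\mu_*)$. Then $H(\mu_1)<\infty$, there are $\alpha\in\mathbb R$ and $\beta>0$ with $\psi(x)\ge\alpha+\beta|x|$ for all $x\in\mathbb R^k$, and the following hold. 1. For all $\alpha\in\mathbb R$, $\beta>0$ such that $\psi(x)\ge\alpha+\beta|x|$ for all $x\in\mathbb R^k$, $$R\le 2\,e^{\frac12(2d+1)H(\mu_1)-\frac12(d+1)\alpha}\Big(\int_{\mathbb R^k}e^{-(\beta|x|+\alpha)/2}\,dx\Big)^{d}\sqrt{\int_{\mathbb R^k}|x|^2e^{-\beta\sum_{i=1}^d|x^i|}\,dx}<\infty.$$ 2. If $r>0$ and $\rho$ satisfies Talagrand's inequality with constant $r$, i.e. $\mathbb W_2^2(\mu,\rho)\le 2rH(\mu\,\|\,\rho)$ for every probability measure $\mu$ on $\mathbb R^k$, then $$R\le2\sqrt{2rH(\mu_1)}<\infty.$$ 3. If $r>0$ and $\rho$ is $r$-subgaussian,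 i.e. $\int_{\mathbb R^k}e^{r|x|^2}\,\rho(dx)<\infty$, then $$R\le\frac{2}{\sqrt r}\Big(H(\mu_1)+\log\int_{\mathbb R^k}e^{r|x|^2}\,\rho(dx)\Big)^{1/2}<\infty.$$ -/

import Mathlib

open MeasureTheory
open scoped ENNReal

namespace CAVI

/-- The Euclidean space `ℝ^k = ℝ^{k 1} × ⋯ × ℝ^{k d}`, written as the product of its blocks.
It carries the product (Borel) σ-algebra, and its `volume` is the product of the Lebesgue measures
of the blocks, i.e. Lebesgue measure. Mathlib's norm on a product type is a maximum, so the
Euclidean norm is `euclNorm` below. -/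
abbrev Blocks {d : ℕ} (k : Fin d → ℕ) : Type := ∀ i, EuclideanSpace ℝ (Fin (k i))

/-- The Euclidean norm `|x|` of `x ∈ ℝ^k`. -/
noncomputable def euclNorm {d : ℕ} {k : Fin d → ℕ} (x : Blocks k) : ℝ :=
  √(∑ i, ‖x i‖ ^ 2)

/-- The target measure `ρ(dx) = e^{-ψ(x)} dx`. -/
noncomputable def target {d : ℕ} {k : Fin d → ℕ} (ψ : Blocks k → ℝ) : Measure (Blocks k) :=
  volume.withDensity fun x => ENNReal.ofReal (Real.exp (-ψ x))

/-- The relative entropy `H(μ) = H(μ ‖ ρ)` with respect to the target measure. -/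
noncomputable def entropy {d : ℕ} {k : Fin d → ℕ} (ψ : Blocks k → ℝ)
    (μ : Measure (Blocks k)) : ℝ≥0∞ :=
  InformationTheory.klDiv μ (target ψ)

/-- Product probability measures, under which the blocks are independent. -/
def productMeasures {d : ℕ} (k : Fin d → ℕ) : Set (Measure (Blocks k)) :=
  {μ | ∃ m : ∀ i, Measure (EuclideanSpace ℝ (Fin (k i))),
    (∀ i, IsProbabilityMeasure (m i)) ∧ μ = Measure.pi m}

/-- `μ` is a minimizer of `H(· ‖ ρ)` among the product probability measures. -/
def IsMFVIMinimizer {d : ℕ} {k : Fin d → ℕ} (ψ : Blocks k → ℝ) (μ : Measure (Blocks k)) : Prop :=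
  μ ∈ productMeasures k ∧ IsMinOn (entropy ψ) (productMeasures k) μ

/-- `x ↦ ∫ ψ(x, y^{-i}) μ^{-i}(dy^{-i})` for `x` in block `i`. The integral is taken over all of
`y = (y^1, …, y^d)`; as the block `y^i` is overwritten by `x` and `μ i` is a probability measure,
this is the integral over the other blocks. -/
noncomputable def potential {d : ℕ} {k : Fin d → ℕ} (ψ : Blocks k → ℝ)
    (μ : ∀ i, Measure (EuclideanSpace ℝ (Fin (k i)))) (i : Fin d)
    (x : EuclideanSpace ℝ (Fin (k i))) : ℝ :=
  ∫ y, ψ (Function.update y i x) ∂(Measure.pi μ)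

/-- One sweep of sequential CAVI through all the blocks: the new measure of block `i` has density
proportional to `exp (-∫ ψ(x, y^{-i}) …)`, where the blocks `j < i` have their new measures and the
blocks `j > i` still have their old ones. (`volume.tilted f` is the probability measure with
Lebesgue density proportional to `exp f`.) -/
noncomputable def sweep {d : ℕ} {k : Fin d → ℕ} (ψ : Blocks k → ℝ)
    (μ : ∀ i, Measure (EuclideanSpace ℝ (Fin (k i)))) (i : Fin d) :
    Measure (EuclideanSpace ℝ (Fin (k i))) :=
  volume.tilted fun x =>
    -potential ψ (fun j => if _h : j < i then sweep ψ μ j else μ j) i x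
termination_by i.val
decreasing_by exact _h

/-- The marginals of the CAVI iterates `μ_n`, started at `μ_0`. -/
noncomputable def iterates {d : ℕ} {k : Fin d → ℕ} (ψ : Blocks k → ℝ)
    (μ₀ : ∀ i, Measure (EuclideanSpace ℝ (Fin (k i)))) :
    ℕ → ∀ i, Measure (EuclideanSpace ℝ (Fin (k i)))
  | 0 => μ₀
  | n + 1 => sweep ψ (iterates ψ μ₀ n)

/-- The CAVI iterates satisfy the defining recursion. -/
theorem iterates_succ {d : ℕ} {k : Fin d → ℕ} (ψ : Blocks k → ℝ)
    (μ₀ : ∀ i, Measure (EuclideanSpace ℝ (Fin (k i)))) (n : ℕ) (i : Fin d) :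
    iterates ψ μ₀ (n + 1) i = volume.tilted fun x =>
      -potential ψ (fun j => if j < i then iterates ψ μ₀ (n + 1) j else iterates ψ μ₀ n j) i x := by
  simp only [iterates]
  rw [sweep]
  simp only [dite_eq_ite]

/-- The CAVI iterate `μ_n = μ_n^1 ⊗ ⋯ ⊗ μ_n^d`. -/
noncomputable def iterate {d : ℕ} {k : Fin d → ℕ} (ψ : Blocks k → ℝ)
    (μ₀ : ∀ i, Measure (EuclideanSpace ℝ (Fin (k i)))) (n : ℕ) : Measure (Blocks k) :=
  Measure.pi (iterates ψ μ₀ n)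

/-- Couplings of `μ` and `ν`. -/
def couplings {d : ℕ} {k : Fin d → ℕ} (μ ν : Measure (Blocks k)) :
    Set (Measure (Blocks k × Blocks k)) :=
  {π | IsProbabilityMeasure π ∧ π.map Prod.fst = μ ∧ π.map Prod.snd = ν}

/-- The quadratic Wasserstein distance, with values in `[0, ∞]`. -/
noncomputable def W2 {d : ℕ} {k : Fin d → ℕ} (μ ν : Measure (Blocks k)) : ℝ≥0∞ :=
  (⨅ π ∈ couplings μ ν, ∫⁻ z, ENNReal.ofReal (euclNorm (z.1 - z.2) ^ 2) ∂π) ^ (1 / 2 : ℝ)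

/-- Talagrand's inequality with constant `r`: `W₂²(μ, ν) ≤ 2 r H(μ ‖ ν)` for all probability
measures `μ`. -/
def Talagrand {d : ℕ} {k : Fin d → ℕ} (r : ℝ) (ν : Measure (Blocks k)) : Prop :=
  ∀ μ : Measure (Blocks k), IsProbabilityMeasure μ →
    W2 μ ν ^ 2 ≤ ENNReal.ofReal (2 * r) * InformationTheory.klDiv μ ν

/-- `ν` is `r`-subgaussian: `∫ e^{r |x|²} dν < ∞`. -/
def Subgaussian {d : ℕ} {k : Fin d → ℕ} (r : ℝ) (ν : Measure (Blocks k)) : Prop :=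
  Integrable (fun x => Real.exp (r * euclNorm x ^ 2)) ν

/-- `R = sup_{n ≥ 1} W₂(μ_n, μ_*)`, with values in `[0, ∞]`. -/
noncomputable def radius {d : ℕ} {k : Fin d → ℕ} (ψ : Blocks k → ℝ)
    (μ₀ : ∀ i, Measure (EuclideanSpace ℝ (Fin (k i)))) (μstar : Measure (Blocks k)) : ℝ≥0∞ :=
  ⨆ (n : ℕ) (_ : 1 ≤ n), W2 (iterate ψ μ₀ n) μstar

end CAVI

namespace CAVI

/-! For a product measure whose marginals have densities of finite entropy and which integrates `ψ`,
`H` is the sum of the negative differential entropies of the marginals plus the mean of `ψ`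
(`entropy_pi`). With all blocks but one fixed, the Gibbs variational principle
(`toReal_klDiv_gibbs`) identifies the excess of `H` over its optimum with the relative entropy of
that block with respect to a Gibbs measure, the density of which is proportional to the exponential
of minus the averaged potential. A CAVI step installs exactly this Gibbs measure, so `H` does not
increase from `μ_1` on (`entropy_iterate_le`). Minimality gives `H(μ_*) ≤ H(μ_1)` as well, and it
remains to bound the distance between two measures of entropy at most `H(μ_1)`.

Under Talagrand's inequality one passes through `ρ`, gluing couplings (`W2_sq_le_of_common`). In the
other two cases the independent coupling reduces the distance to second moments
(`W2_sq_le_moments`). In the subgaussian case these follow from the Donsker–Varadhan inequality with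
test function `r|x|²`.

For the bound in `α`, `β`, every marginal of an iterate or of the minimizer is a Gibbs measure, so
its density is at most `exp (c_i - α - β|x|)` with `c_i = -log Z_i`. By the variational principle
`c_i` is the negative entropy of the marginal plus the mean of `ψ` just after the update, and
Donsker–Varadhan bounds that mean by `2H + 2 log I`, where `I` is the integral of `exp (-(β|x| +
α)/2)`. Summing over `i`, with the negative entropies adding up to `H` minus the mean of `ψ`, hence
to at most `H - α`, produces the stated constant (`lintegral_sq_le`).

The first sweep escapes this argument when `d ≥ 2`: its intermediate measures still contain blocks
of `μ_0` and may have infinite entropy. There convexity enters again. The marginals of `μ_1` are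
log-concave, so their second moments are controlled by their first moments
(`integral_norm_sq_le_of_logConcave`), the first moment is controlled by `H(μ_1)`
(`integral_euclNorm_le`), and an elementary inequality (`moment_bound_numeric`) shows that the
result is below the required bound. -/

theorem continuous_of_convexOn_univ {E : Type*} [NormedAddCommGroup E] [NormedSpace ℝ E]
    [FiniteDimensional ℝ E] {ψ : E → ℝ} (h : ConvexOn ℝ Set.univ ψ) : Continuous ψ :=
  h.locallyLipschitz.continuous

/-! ### Linear growth of convex functions with integrable exponential. -/

section Convex

variable {E : Type*} [NormedAddCommGroup E] [NormedSpace ℝ E] [FiniteDimensional ℝ E]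
  [MeasurableSpace E] [BorelSpace E]

theorem integrable_exp_neg_mul_norm (μ : Measure E) [μ.IsAddHaarMeasure] {b : ℝ} (hb : 0 < b) :
    Integrable (fun x => Real.exp (-(b * ‖x‖))) μ := by
  -- Any power beyond the dimension makes `(1 + ‖x‖) ^ (-n)` integrable.
  set n := Module.finrank ℝ E + 1
  have hI : Integrable (fun x : E => (1 + ‖x‖) ^ (-(n : ℝ))) μ :=
    integrable_one_add_norm (by simp [n])
  refine (hI.const_mul ((n.factorial : ℝ) / b ^ n * Real.exp b)).mono'
    (by fun_prop) (Filter.Eventually.of_forall fun x => ?_)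
  rw [Real.norm_eq_abs, abs_of_pos (Real.exp_pos _)]
  have h1 : 0 < 1 + ‖x‖ := by positivity
  have h2 := Real.pow_div_factorial_le_exp (b * (1 + ‖x‖)) (by positivity) n
  rw [Real.rpow_neg h1.le, Real.rpow_natCast]
  have h3 : Real.exp (-(b * ‖x‖)) = Real.exp b * (Real.exp (b * (1 + ‖x‖)))⁻¹ := by
    rw [← Real.exp_neg, ← Real.exp_add]; congr 1; ring
  rw [h3]
  have h4 : (Real.exp (b * (1 + ‖x‖)))⁻¹ ≤ ((b * (1 + ‖x‖)) ^ n / n.factorial)⁻¹ :=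
    inv_anti₀ (by positivity) h2
  calc _ ≤ Real.exp b * ((b * (1 + ‖x‖)) ^ n / n.factorial)⁻¹ := by gcongr
    _ = _ := by rw [mul_pow]; field_simp

theorem rpow_mul_exp_neg_le {q b : ℝ} (hq : 0 ≤ q) (hb : 0 < b) :
    ∃ C, 0 ≤ C ∧ ∀ r : ℝ, 0 ≤ r → r ^ q * Real.exp (-(b * r)) ≤ C * Real.exp (-(b / 2 * r)) := by
  obtain ⟨n, hn⟩ := exists_nat_ge q
  refine ⟨1 + n.factorial / (b / 2) ^ n, by positivity, fun r hr => ?_⟩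
  have h1 : r ^ q ≤ 1 + r ^ n := by
    rcases le_total r 1 with h | h
    · exact (Real.rpow_le_one hr h hq).trans (by linarith [pow_nonneg hr n])
    · rw [← Real.rpow_natCast]
      linarith [Real.rpow_le_rpow_of_exponent_le h hn]
  have h2 := Real.pow_div_factorial_le_exp (b / 2 * r) (by positivity) n
  have h3 : r ^ n ≤ n.factorial / (b / 2) ^ n * Real.exp (b / 2 * r) := by
    rw [div_le_iff₀ (by positivity), mul_pow] at h2
    rw [div_mul_eq_mul_div, le_div_iff₀ (by positivity)]
    linarith
  have h4 : 1 ≤ Real.exp (b / 2 * r) := Real.one_le_exp (by positivity)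
  have h5 : Real.exp (-(b / 2 * r)) = Real.exp (b / 2 * r) * Real.exp (-(b * r)) := by
    rw [← Real.exp_add]; congr 1; ring
  rw [h5, ← mul_assoc]
  gcongr
  linarith

theorem integrable_of_norm_le_rpow_mul_exp (μ : Measure E) [μ.IsAddHaarMeasure] {F : Type*}
    [NormedAddCommGroup F] {f : E → F} (hf : AEStronglyMeasurable f μ) {C q b : ℝ} (hC : 0 ≤ C)
    (hq : 0 ≤ q) (hb : 0 < b)
    (h : ∀ x, ‖f x‖ ≤ C * (‖x‖ ^ q * Real.exp (-(b * ‖x‖)))) : Integrable f μ := by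
  obtain ⟨K, -, hK⟩ := rpow_mul_exp_neg_le hq hb
  refine ((integrable_exp_neg_mul_norm μ (half_pos hb)).const_mul (C * K)).mono' hf
    (Filter.Eventually.of_forall fun x => (h x).trans ?_)
  rw [mul_assoc]
  exact mul_le_mul_of_nonneg_left (hK _ (norm_nonneg _)) hC

theorem integrable_of_norm_le_exp (μ : Measure E) [μ.IsAddHaarMeasure] {F : Type*}
    [NormedAddCommGroup F] {f : E → F} (hf : AEStronglyMeasurable f μ) {C b : ℝ} (hC : 0 ≤ C)
    (hb : 0 < b) (h : ∀ x, ‖f x‖ ≤ C * Real.exp (-(b * ‖x‖))) : Integrable f μ :=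
  integrable_of_norm_le_rpow_mul_exp μ hf hC le_rfl hb (by simpa using h)

/-- A convex set of finite measure that contains a ball is bounded. -/
theorem convex_bounded_of_measure_lt_top (μ : Measure E) [μ.IsAddHaarMeasure] {C : Set E}
    (hC : Convex ℝ C) {r : ℝ} (hr : 0 < r) (hball : Metric.ball 0 r ⊆ C) (hfin : μ C < ∞) :
    ∃ R, ∀ x ∈ C, ‖x‖ ≤ R := by
  set v := μ (Metric.ball (0 : E) (r / 2))
  have hv : v ≠ 0 := (Metric.measure_ball_pos μ 0 (half_pos hr)).ne'
  have hv' : v ≠ ∞ := measure_ball_lt_top.ne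
  -- `N` disjoint balls of radius `r / 2` would have more volume than `C`. A point of norm above `2
  -- * N * r` makes room for them along the first half of the segment from the origin, at spacing
  -- more than `r`.
  obtain ⟨N, hN⟩ := ENNReal.exists_nat_mul_gt hv hfin.ne
  refine ⟨2 * N * r, fun x hx => ?_⟩
  by_contra! hlt
  refine absurd hN (not_lt.2 ?_)
  rcases Nat.eq_zero_or_pos N with rfl | hNpos
  · simp
  have hN0 : (0 : ℝ) < N := by exact_mod_cast hNpos
  set c : ℕ → E := fun j => ((j : ℝ) / (2 * N)) • x
  have hsub : ∀ j ∈ Finset.range N, Metric.ball (c j) (r / 2) ⊆ C := by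
    intro j hj z hz
    have hj' : (j : ℝ) < N := by exact_mod_cast Finset.mem_range.1 hj
    set t : ℝ := (j : ℝ) / (2 * N)
    have ht0 : 0 ≤ t := by positivity
    have ht : t ≤ 1 / 2 := by
      rw [div_le_iff₀ (by positivity)]; linarith
    have h1t : 0 < 1 - t := by linarith
    have hz' : ‖z - t • x‖ < r / 2 := by simpa [c, t, dist_eq_norm] using hz
    -- `z` is a convex combination of `x` and this point; as `1 - t ≥ 1 / 2`, rescaling turns radius
    -- `r / 2` into at most `r`.
    have hw : (1 - t)⁻¹ • (z - t • x) ∈ C := by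
      apply hball
      rw [mem_ball_zero_iff, norm_smul, norm_inv, Real.norm_eq_abs, abs_of_pos h1t,
        inv_mul_lt_iff₀ h1t]
      nlinarith
    have := hC hx hw ht0 h1t.le (by ring)
    rwa [smul_smul, mul_inv_cancel₀ h1t.ne', one_smul, add_sub_cancel] at this
  have hdisj : Set.PairwiseDisjoint (↑(Finset.range N)) fun j => Metric.ball (c j) (r / 2) := by
    intro i _ j _ hij
    apply Metric.ball_disjoint_ball
    have h1 : dist (c i) (c j) = |(i : ℝ) - j| / (2 * N) * ‖x‖ := by
      rw [dist_eq_norm, ← sub_smul, norm_smul, ← sub_div, Real.norm_eq_abs, abs_div,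
        abs_of_pos (by positivity : (0 : ℝ) < 2 * N)]
    have h2 : (1 : ℝ) ≤ |(i : ℝ) - j| := by
      have : (1 : ℤ) ≤ |(i : ℤ) - j| := Int.one_le_abs (by omega)
      exact_mod_cast this
    rw [h1, add_halves, div_mul_eq_mul_div, le_div_iff₀ (by positivity)]
    nlinarith [norm_nonneg x]
  calc (N : ℝ≥0∞) * v = ∑ j ∈ Finset.range N, μ (Metric.ball (c j) (r / 2)) := by
        simp [v, Measure.addHaar_ball_center]
    _ = μ (⋃ j ∈ Finset.range N, Metric.ball (c j) (r / 2)) :=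
        (measure_biUnion_finset hdisj fun _ _ => measurableSet_ball).symm
    _ ≤ μ C := measure_mono (Set.iUnion₂_subset hsub)

/-- A convex function with `∫ exp (-ψ) < ∞` grows at least linearly. -/
theorem exists_linear_lower_bound (μ : Measure E) [μ.IsAddHaarMeasure] {ψ : E → ℝ}
    (hψ : ConvexOn ℝ Set.univ ψ) (hfin : ∫⁻ x, ENNReal.ofReal (Real.exp (-ψ x)) ∂μ < ∞) :
    ∃ a b : ℝ, 0 < b ∧ ∀ x, a + b * ‖x‖ ≤ ψ x := by
  have hcont := continuous_of_convexOn_univ hψ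
  set C : Set E := {x | ψ x ≤ ψ 0 + 1}
  have hCconv : Convex ℝ C := by simpa [C] using hψ.convex_le (ψ 0 + 1)
  have hnhds : C ∈ nhds (0 : E) :=
    Filter.mem_of_superset (hcont.continuousAt.eventually_lt continuousAt_const
      (lt_add_one (ψ 0))) fun x (hx : ψ x < ψ 0 + 1) => hx.le
  obtain ⟨r, hr, hball⟩ := Metric.mem_nhds_iff.1 hnhds
  -- Markov's inequality: `exp (-ψ)` is bounded below on the sublevel set.
  have hCfin : μ C < ∞ := by
    have h := mul_meas_ge_le_lintegral₀ (μ := μ)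
      (f := fun x => ENNReal.ofReal (Real.exp (-ψ x))) (by fun_prop)
      (ENNReal.ofReal (Real.exp (-(ψ 0 + 1))))
    refine lt_of_le_of_lt (measure_mono (t := {x | ENNReal.ofReal (Real.exp (-(ψ 0 + 1)))
      ≤ ENNReal.ofReal (Real.exp (-ψ x))}) fun x hx => ?_)
      (lt_of_mul_lt_mul_left' (a := ENNReal.ofReal (Real.exp (-(ψ 0 + 1)))) ?_)
    · exact ENNReal.ofReal_le_ofReal (Real.exp_le_exp.2 (neg_le_neg hx))
    · refine (h.trans_lt hfin).trans_eq ?_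
      rw [ENNReal.mul_top (by simp [Real.exp_pos])]
  obtain ⟨R, hR⟩ := convex_bounded_of_measure_lt_top μ hCconv hr hball hCfin
  set R' := max R 0 + 1
  have hR'0 : 0 < R' := by positivity
  have hR' : R < R' := lt_of_le_of_lt (le_max_left _ _) (lt_add_one _)
  obtain ⟨y, -, hy⟩ := (isCompact_closedBall (0 : E) R').exists_isMinOn
    ⟨0, by simp [hR'0.le]⟩ hcont.continuousOn
  -- Inside the ball of radius `R'` the `-1` absorbs the linear term. Outside, `ψ` has already risen
  -- by `1` at radius `R'`, and convexity along the ray propagates the slope `1 / R'`.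
  refine ⟨min (ψ 0) (ψ y) - 1, 1 / R', by positivity, fun x => ?_⟩
  rcases le_total ‖x‖ R' with hx | hx
  · have h1 : ψ y ≤ ψ x := hy (by simpa using hx)
    have h2 : 1 / R' * ‖x‖ ≤ 1 := by
      rw [one_div, inv_mul_le_iff₀ hR'0]; linarith
    linarith [min_le_right (ψ 0) (ψ y)]
  · have hx0 : 0 < ‖x‖ := hR'0.trans_le hx
    set t := R' / ‖x‖
    have ht : t ≤ 1 := (div_le_one hx0).2 hx
    have ht0 : 0 < t := by positivity
    have h1 : ψ 0 + 1 < ψ (t • x) := by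
      by_contra! h
      have := hR _ h
      rw [norm_smul, Real.norm_eq_abs, abs_of_pos ht0, div_mul_cancel₀ _ hx0.ne'] at this
      linarith
    have h2 := hψ.2 (Set.mem_univ x) (Set.mem_univ 0) ht0.le (sub_nonneg.2 ht) (by ring)
    simp only [smul_zero, add_zero, smul_eq_mul] at h2
    have h3 : 1 / t < ψ x - ψ 0 := by
      rw [div_lt_iff₀ ht0]; nlinarith
    have h4 : 1 / R' * ‖x‖ = 1 / t := by simp only [t]; field_simp
    linarith [min_le_left (ψ 0) (ψ y)]

end Convex

end CAVI

/-! ### Moments of log-concave densities, and the Donsker–Varadhan inequality. -/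

namespace CAVI

section LogConcave

variable {E : Type*} [NormedAddCommGroup E] [InnerProductSpace ℝ E] [FiniteDimensional ℝ E]
  [MeasurableSpace E] [BorelSpace E]

theorem integral_comp_affine (μ : Measure E) [μ.IsAddHaarMeasure] (g : E → ℝ) {t : ℝ} (ht : 0 < t)
    (v : E) : ∫ y, g (v + t • y) ∂μ = (t ^ Module.finrank ℝ E)⁻¹ * ∫ y, g y ∂μ := by
  have h := Measure.integral_comp_smul_of_nonneg μ (fun y => g (v + y)) t (hR := ht.le)
  rw [h, integral_add_left_eq_self, smul_eq_mul]

/-- Reverse Hölder inequality between the first two moments of a log-concave probability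
density. -/
theorem integral_norm_sq_le_of_logConcave (μ : Measure E) [μ.IsAddHaarMeasure] {V : E → ℝ}
    (hV : ConvexOn ℝ Set.univ V) {a b : ℝ} (hb : 0 < b) (hab : ∀ x, a + b * ‖x‖ ≤ V x)
    (h1 : ∫ x, Real.exp (-V x) ∂μ = 1) :
    ∫ x, ‖x‖ ^ 2 * Real.exp (-V x) ∂μ ≤
      16 * (32 / 9) ^ Module.finrank ℝ E * (∫ x, ‖x‖ * Real.exp (-V x) ∂μ) ^ 2 := by
  have hcont := continuous_of_convexOn_univ hV
  set n := Module.finrank ℝ E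
  have hle : ∀ x, Real.exp (-V x) ≤ Real.exp (-a) * Real.exp (-(b * ‖x‖)) := fun x => by
    rw [← Real.exp_add]; exact Real.exp_le_exp.2 (by linarith [hab x])
  have hint : ∀ q : ℕ, Integrable (fun x => ‖x‖ ^ q * Real.exp (-V x)) μ := fun q => by
    refine integrable_of_norm_le_rpow_mul_exp μ (by fun_prop) (Real.exp_pos (-a)).le
      (Nat.cast_nonneg q) hb fun x => ?_
    rw [Real.norm_eq_abs, abs_of_nonneg (by positivity), Real.rpow_natCast]
    calc _ ≤ ‖x‖ ^ q * (Real.exp (-a) * Real.exp (-(b * ‖x‖))) := by gcongr; exact hle x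
      _ = _ := by ring
  have hint0 : Integrable (fun x => Real.exp (-V x)) μ := by simpa using hint 0
  have hint1 : Integrable (fun x => ‖x‖ * Real.exp (-V x)) μ := by simpa using hint 1
  have hintv : Integrable (fun x => Real.exp (-V x) • x) μ :=
    hint1.mono' (by fun_prop) (Filter.Eventually.of_forall fun x => by
      rw [norm_smul, Real.norm_eq_abs, abs_of_pos (Real.exp_pos _), mul_comm])
  -- a minimizer of `V`
  obtain ⟨y₀, hy₀⟩ : ∃ y₀, ∀ x, V y₀ ≤ V x := by
    refine hcont.exists_forall_le (Filter.tendsto_atTop_mono hab ?_)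
    exact Filter.tendsto_atTop_add_const_left _ _
      (Filter.Tendsto.const_mul_atTop hb (tendsto_norm_cocompact_atTop (E := E)))
  set M := ∫ x, ‖x‖ * Real.exp (-V x) ∂μ
  have hM0 : 0 ≤ M := integral_nonneg fun x => by positivity
  set m : E := ∫ x, Real.exp (-V x) • x ∂μ
  set s : E → ℝ := fun x => V x - V y₀
  -- `(x + 3m) / 4` is the mean of `x/4 + 3y/4` when `y` has density `exp (-V)`. Convexity and
  -- minimality of `y₀` give `V (x/4 + 3y/4) ≤ s x / 4 + V y`, so up to `exp (s x / 4)` the mean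
  -- norm is an integral against `exp (-V)` after an affine change of variables with Jacobian factor
  -- `(4/3) ^ n`.
  have key : ∀ x, ‖x + (3 : ℝ) • m‖ ≤ 4 * (4 / 3) ^ n * M * Real.exp (s x / 4) := by
    intro x
    have hcv : ∫ y, ‖(1 / 4 : ℝ) • x + (3 / 4 : ℝ) • y‖ *
        Real.exp (-V ((1 / 4 : ℝ) • x + (3 / 4 : ℝ) • y)) ∂μ = (4 / 3) ^ n * M := by
      rw [integral_comp_affine μ (fun z => ‖z‖ * Real.exp (-V z)) (by norm_num) ((1 / 4 : ℝ) • x),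
        ← inv_pow]
      norm_num [n, M]
    have hi1 : Integrable (fun y => ‖(1 / 4 : ℝ) • x + (3 / 4 : ℝ) • y‖ *
        Real.exp (-V ((1 / 4 : ℝ) • x + (3 / 4 : ℝ) • y))) μ := by
      have := (hint1.comp_add_left ((1 / 4 : ℝ) • x)).comp_smul (R := (3 / 4 : ℝ)) (by norm_num)
      exact this
    have hvec : ∫ y, Real.exp (-V y) • ((1 / 4 : ℝ) • x + (3 / 4 : ℝ) • y) ∂μ
        = (1 / 4 : ℝ) • (x + (3 : ℝ) • m) := by
      have e : ∀ y, Real.exp (-V y) • ((1 / 4 : ℝ) • x + (3 / 4 : ℝ) • y)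
          = Real.exp (-V y) • ((1 / 4 : ℝ) • x) + (3 / 4 : ℝ) • (Real.exp (-V y) • y) := fun y => by
        rw [smul_add, smul_comm (Real.exp (-V y)) (3 / 4 : ℝ)]
      simp_rw [e]
      have hintv' : Integrable (fun y => (3 / 4 : ℝ) • (Real.exp (-V y) • y)) μ := hintv.smul _
      rw [integral_add (hint0.smul_const _) hintv', integral_smul_const, integral_smul, h1]
      simp only [smul_add, smul_smul]; norm_num [m]
    have hi2 : Integrable (fun y => ‖(1 / 4 : ℝ) • x + (3 / 4 : ℝ) • y‖ *
        (Real.exp (-(s x / 4)) * Real.exp (-V y))) μ := by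
      have : Integrable (fun y => (Real.exp (-(s x / 4))) * (‖Real.exp (-V y) • ((1 / 4 : ℝ) • x)
          + (3 / 4 : ℝ) • (Real.exp (-V y) • y)‖)) μ :=
        (((hint0.smul_const ((1 / 4 : ℝ) • x)).add (hintv.smul (3 / 4 : ℝ))).norm).const_mul _
      refine this.congr (Filter.Eventually.of_forall fun y => ?_)
      simp only
      rw [smul_comm (3 / 4 : ℝ), ← smul_add, norm_smul, Real.norm_eq_abs,
        abs_of_pos (Real.exp_pos _)]
      ring
    have hle2 : ∫ y, ‖(1 / 4 : ℝ) • x + (3 / 4 : ℝ) • y‖ *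
        (Real.exp (-(s x / 4)) * Real.exp (-V y)) ∂μ ≤ (4 / 3) ^ n * M := by
      rw [← hcv]
      refine integral_mono hi2 hi1 fun y => ?_
      refine mul_le_mul_of_nonneg_left ?_ (norm_nonneg _)
      rw [← Real.exp_add]
      refine Real.exp_le_exp.2 ?_
      have := hV.2 (Set.mem_univ x) (Set.mem_univ y) (by norm_num : (0 : ℝ) ≤ 1 / 4)
        (by norm_num : (0 : ℝ) ≤ 3 / 4) (by norm_num)
      simp only [smul_eq_mul] at this
      have := hy₀ y
      simp only [s]; linarith
    have hge : Real.exp (-(s x / 4)) * ((1 / 4 : ℝ) * ‖x + (3 : ℝ) • m‖) ≤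
        ∫ y, ‖(1 / 4 : ℝ) • x + (3 / 4 : ℝ) • y‖ * (Real.exp (-(s x / 4)) * Real.exp (-V y)) ∂μ := by
      have e : ∀ y, ‖(1 / 4 : ℝ) • x + (3 / 4 : ℝ) • y‖ *
          (Real.exp (-(s x / 4)) * Real.exp (-V y)) = Real.exp (-(s x / 4)) *
            ‖Real.exp (-V y) • ((1 / 4 : ℝ) • x + (3 / 4 : ℝ) • y)‖ := fun y => by
        rw [norm_smul (Real.exp (-V y)), Real.norm_eq_abs, abs_of_pos (Real.exp_pos _)]; ring
      simp_rw [e]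
      rw [integral_const_mul]
      refine mul_le_mul_of_nonneg_left ?_ (Real.exp_pos _).le
      refine le_trans (le_of_eq ?_) (norm_integral_le_integral_norm _)
      rw [hvec, norm_smul]; norm_num
    have h5 := hge.trans hle2
    have h6 : Real.exp (s x / 4) * Real.exp (-(s x / 4)) = 1 := by
      rw [← Real.exp_add]; simp
    calc ‖x + (3 : ℝ) • m‖ = 4 * Real.exp (s x / 4) *
          (Real.exp (-(s x / 4)) * ((1 / 4 : ℝ) * ‖x + (3 : ℝ) • m‖)) := by
          linear_combination (-‖x + (3 : ℝ) • m‖) * h6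
      _ ≤ 4 * Real.exp (s x / 4) * ((4 / 3) ^ n * M) := by gcongr
      _ = _ := by ring
  -- Convexity at the midpoint of `y₀` and `x`; the dilation by `1 / 2` then costs `2 ^ n`. This
  -- makes the square of `key` integrable.
  have hhalf : ∀ x, Real.exp (s x / 2) * Real.exp (-V x) ≤
      Real.exp (-V ((1 / 2 : ℝ) • y₀ + (1 / 2 : ℝ) • x)) := fun x => by
    rw [← Real.exp_add]
    refine Real.exp_le_exp.2 ?_
    have := hV.2 (Set.mem_univ y₀) (Set.mem_univ x) (by norm_num : (0 : ℝ) ≤ 1 / 2)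
      (by norm_num : (0 : ℝ) ≤ 1 / 2) (by norm_num)
    simp only [smul_eq_mul] at this
    simp only [s]; linarith
  have hI2 : Integrable (fun x => Real.exp (-V ((1 / 2 : ℝ) • y₀ + (1 / 2 : ℝ) • x))) μ :=
    (hint0.comp_add_left ((1 / 2 : ℝ) • y₀)).comp_smul (R := (1 / 2 : ℝ)) (by norm_num)
  have hI3 : Integrable (fun x => Real.exp (s x / 2) * Real.exp (-V x)) μ :=
    hI2.mono' (by fun_prop) (Filter.Eventually.of_forall fun x => by
      rw [Real.norm_eq_abs, abs_of_pos (by positivity)]; exact hhalf x)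
  have hexp : ∫ x, Real.exp (s x / 2) * Real.exp (-V x) ∂μ ≤ 2 ^ n := by
    refine (integral_mono hI3 hI2 hhalf).trans (le_of_eq ?_)
    rw [integral_comp_affine μ (fun z => Real.exp (-V z)) (by norm_num) ((1 / 2 : ℝ) • y₀), h1,
      ← inv_pow]
    norm_num [n]
  have hinner : Integrable (fun x => inner ℝ m (Real.exp (-V x) • x)) μ := hintv.const_inner m
  have hexpand : ∀ x, ‖x + (3 : ℝ) • m‖ ^ 2 * Real.exp (-V x) = ‖x‖ ^ 2 * Real.exp (-V x)
      + 6 * inner ℝ m (Real.exp (-V x) • x) + 9 * ‖m‖ ^ 2 * Real.exp (-V x) := fun x => by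
    rw [norm_add_sq_real, inner_smul_right, inner_smul_right, norm_smul, real_inner_comm]
    norm_num; ring
  -- Since `m` is the mean, the cross term integrates to `6 * ‖m‖ ^ 2 ≥ 0`, so the shift by `3m`
  -- only increases the second moment.
  have hlow : ∫ x, ‖x‖ ^ 2 * Real.exp (-V x) ∂μ ≤
      ∫ x, ‖x + (3 : ℝ) • m‖ ^ 2 * Real.exp (-V x) ∂μ := by
    simp_rw [hexpand]
    have hsum : Integrable (fun x => ‖x‖ ^ 2 * Real.exp (-V x)
        + 6 * inner ℝ m (Real.exp (-V x) • x)) μ := (hint 2).add (hinner.const_mul 6)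
    rw [integral_add hsum (hint0.const_mul _),
      integral_add (hint 2) (hinner.const_mul 6), integral_const_mul, integral_const_mul,
      integral_inner hintv]
    have : inner ℝ m (∫ x, Real.exp (-V x) • x ∂μ) = ‖m‖ ^ 2 := real_inner_self_eq_norm_sq m
    rw [this, h1]
    nlinarith [sq_nonneg ‖m‖]
  refine hlow.trans ?_
  calc ∫ x, ‖x + (3 : ℝ) • m‖ ^ 2 * Real.exp (-V x) ∂μ
      ≤ ∫ x, 16 * (16 / 9) ^ n * M ^ 2 * (Real.exp (s x / 2) * Real.exp (-V x)) ∂μ := by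
        refine integral_mono_of_nonneg (Filter.Eventually.of_forall fun x => by positivity)
          (hI3.const_mul _) (Filter.Eventually.of_forall fun x => ?_)
        have h7 : (4 * (4 / 3) ^ n * M * Real.exp (s x / 4)) ^ 2 =
            16 * (16 / 9) ^ n * M ^ 2 * Real.exp (s x / 2) := by
          have : Real.exp (s x / 2) = Real.exp (s x / 4) ^ 2 := by
            rw [← Real.exp_nat_mul]; congr 1; push_cast; ring
          rw [this, mul_pow, mul_pow, mul_pow, ← pow_mul, mul_comm n 2, pow_mul]
          norm_num
        simp only
        rw [← mul_assoc, ← h7]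
        gcongr
        exact key x
    _ = 16 * (16 / 9) ^ n * M ^ 2 * ∫ x, Real.exp (s x / 2) * Real.exp (-V x) ∂μ :=
        integral_const_mul _ _
    _ ≤ 16 * (16 / 9) ^ n * M ^ 2 * 2 ^ n := by gcongr
    _ = 16 * (32 / 9) ^ n * M ^ 2 := by
        rw [show (32 / 9 : ℝ) = 16 / 9 * 2 by norm_num, mul_pow]; ring

end LogConcave

/-- The Donsker–Varadhan inequality, for functions that are bounded below. -/
theorem integrable_and_integral_le_klDiv_add_log {Ω : Type*} [MeasurableSpace Ω]
    {μ ρ : Measure Ω} [IsProbabilityMeasure μ] [IsProbabilityMeasure ρ] {φ : Ω → ℝ}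
    (hφ : Measurable φ) {C : ℝ} (hC : ∀ x, C ≤ φ x)
    (hexp : Integrable (fun x => Real.exp (φ x)) ρ) (hfin : InformationTheory.klDiv μ ρ ≠ ∞) :
    Integrable φ μ ∧ ∫ x, φ x ∂μ ≤
      (InformationTheory.klDiv μ ρ).toReal + Real.log (∫ x, Real.exp (φ x) ∂ρ) := by
  obtain ⟨hac, hllr⟩ := InformationTheory.klDiv_ne_top_iff.1 hfin
  set B := (InformationTheory.klDiv μ ρ).toReal + Real.log (∫ x, Real.exp (φ x) ∂ρ)
  have hKL : (InformationTheory.klDiv μ ρ).toReal = ∫ x, llr μ ρ x ∂μ :=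
    InformationTheory.toReal_klDiv_of_measure_eq hac (by simp)
  have hmin : ∀ n : ℕ, ∀ x, |min (φ x) n| ≤ max |C| n := fun n x => by
    rw [abs_le]
    constructor
    · rcases le_total (φ x) n with h | h
      · rw [min_eq_left h]; linarith [hC x, neg_abs_le C, le_max_left |C| (n : ℝ)]
      · rw [min_eq_right h]; linarith [abs_nonneg C, le_max_left |C| (n : ℝ), n.cast_nonneg (α := ℝ)]
    · exact (min_le_right _ _).trans (le_max_right _ _)
  have hbd : ∀ n : ℕ, ∀ ν : Measure Ω, IsProbabilityMeasure ν →
      Integrable (fun x => min (φ x) n) ν := fun n ν _ =>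
    Integrable.of_bound (by fun_prop) (max |C| n) (Filter.Eventually.of_forall (hmin n))
  -- For bounded test functions the inequality is nonnegativity of the relative entropy with respect
  -- to the tilted measure; truncation reduces to that case.
  have htr : ∀ n : ℕ, ∫ x, min (φ x) n ∂μ ≤ B := fun n => by
    have hexpn : Integrable (fun x => Real.exp (min (φ x) n)) ρ :=
      hexp.mono' (by fun_prop) (Filter.Eventually.of_forall fun x => by
        rw [Real.norm_eq_abs, abs_of_pos (Real.exp_pos _)]
        exact Real.exp_le_exp.2 (min_le_left _ _))
    have := isProbabilityMeasure_tilted hexpn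
    have h1 := integral_llr_tilted_right hac (hbd n μ inferInstance) hexpn hllr
    have hac' : μ ≪ ρ.tilted fun x => min (φ x) n := hac.trans (absolutelyContinuous_tilted hexpn)
    have h2 : 0 ≤ ∫ x, llr μ (ρ.tilted fun x => min (φ x) n) x ∂μ := by
      rw [← InformationTheory.toReal_klDiv_of_measure_eq hac' (by simp)]
      exact ENNReal.toReal_nonneg
    have h3 : Real.log (∫ x, Real.exp (min (φ x) n) ∂ρ) ≤ Real.log (∫ x, Real.exp (φ x) ∂ρ) := by
      refine Real.log_le_log (integral_exp_pos hexpn) (integral_mono hexpn hexp fun x => ?_)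
      exact Real.exp_le_exp.2 (min_le_left _ _)
    simp only [B]
    linarith
  have hmono : ∀ᵐ x ∂μ, Monotone fun n : ℕ => min (φ x) n :=
    Filter.Eventually.of_forall fun x i j hij => min_le_min_left _ (by exact_mod_cast hij)
  have hlim : ∀ᵐ x ∂μ, Filter.Tendsto (fun n : ℕ => min (φ x) n) Filter.atTop (nhds (φ x)) := by
    refine Filter.Eventually.of_forall fun x => tendsto_const_nhds.congr' ?_
    obtain ⟨N, hN⟩ := exists_nat_ge (φ x)
    filter_upwards [Filter.eventually_ge_atTop N] with n hn
    rw [min_eq_left (hN.trans (by exact_mod_cast hn))]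
  -- The shift is by `min C 0` and not `C`, because the truncation level `n ≥ 0` may lie below `C`.
  have hle : ∀ n : ℕ, ∫⁻ x, ENNReal.ofReal (min (φ x) n - min C 0) ∂μ ≤
      ENNReal.ofReal (B - min C 0) := fun n => by
    have hsub : Integrable (fun x => min (φ x) n - min C 0) μ :=
      (hbd n μ inferInstance).sub (integrable_const _)
    rw [← ofReal_integral_eq_lintegral_ofReal hsub
      (Filter.Eventually.of_forall fun x => sub_nonneg.2 (le_min ((min_le_left _ _).trans (hC x))
        ((min_le_right _ _).trans n.cast_nonneg))), integral_sub (hbd n μ inferInstance)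
        (integrable_const _)]
    refine ENNReal.ofReal_le_ofReal ?_
    simpa using htr n
  have hint : Integrable φ μ := by
    have h1 : ∫⁻ x, ENNReal.ofReal (φ x - min C 0) ∂μ ≤ ENNReal.ofReal (B - min C 0) := by
      refine le_of_tendsto' (lintegral_tendsto_of_tendsto_of_monotone (μ := μ)
        (f := fun n x => ENNReal.ofReal (min (φ x) n - min C 0)) (fun n => by fun_prop) ?_ ?_) hle
      · filter_upwards [hmono] with x hx i j hij
        exact ENNReal.ofReal_le_ofReal (by linarith [hx hij])
      · filter_upwards [hlim] with x hx
        exact ENNReal.tendsto_ofReal (hx.sub_const _)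
    have h2 : Integrable (fun x => φ x - min C 0) μ := by
      refine (lintegral_ofReal_ne_top_iff_integrable (by fun_prop)
        (Filter.Eventually.of_forall fun x => ?_)).1 (h1.trans_lt ENNReal.ofReal_lt_top).ne
      exact sub_nonneg.2 ((min_le_left _ _).trans (hC x))
    exact (h2.add (integrable_const (min C 0))).congr
      (Filter.Eventually.of_forall fun x => by simp)
  exact ⟨hint, le_of_tendsto' (integral_tendsto_of_tendsto_of_monotone
    (fun n => hbd n μ inferInstance) hint hmono hlim) htr⟩

end CAVI

/-! ### Product measures: densities, log-likelihood ratios, overwriting one coordinate. -/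

namespace CAVI

section Pi

theorem lintegral_fin_pi_prod {n : ℕ} {X : Fin n → Type*} [∀ i, MeasurableSpace (X i)]
    (μ : ∀ i, Measure (X i)) [∀ i, SigmaFinite (μ i)] {f : ∀ i, X i → ℝ≥0∞}
    (hf : ∀ i, Measurable (f i)) :
    ∫⁻ x, ∏ i, f i (x i) ∂(Measure.pi μ) = ∏ i, ∫⁻ x, f i x ∂(μ i) := by
  induction n with
  | zero => simp
  | succ n ih =>
      calc
        _ = ∫⁻ x : X 0 × (∀ i : Fin n, X i.succ), f 0 x.1 * ∏ i : Fin n, f i.succ (x.2 i)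
            ∂((μ 0).prod (Measure.pi fun i => μ i.succ)) := by
          rw [← ((measurePreserving_piFinSuccAbove μ 0).symm).lintegral_comp_emb
            (MeasurableEquiv.measurableEmbedding _)]
          refine lintegral_congr fun x => ?_
          rw [Fin.prod_univ_succ]
          rfl
        _ = (∫⁻ x, f 0 x ∂μ 0) * ∏ i : Fin n, ∫⁻ x, f i.succ x ∂(μ i.succ) := by
          rw [← ih (fun i => μ i.succ) fun i => hf i.succ, lintegral_prod_mul
            (g := fun x : ∀ i : Fin n, X i.succ => ∏ i : Fin n, f i.succ (x i))
            (hf 0).aemeasurable (Finset.measurable_prod _ fun i _ =>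
              (hf i.succ).comp (measurable_pi_apply i)).aemeasurable]
        _ = _ := by rw [Fin.prod_univ_succ]

variable {d : ℕ} {X : Fin d → Type*} [∀ i, MeasurableSpace (X i)]

theorem pi_withDensity (μ : ∀ i, Measure (X i)) [∀ i, SigmaFinite (μ i)] {g : ∀ i, X i → ℝ≥0∞}
    (hg : ∀ i, Measurable (g i)) [∀ i, SigmaFinite ((μ i).withDensity (g i))] :
    Measure.pi (fun i => (μ i).withDensity (g i)) =
      (Measure.pi μ).withDensity fun x => ∏ i, g i (x i) := by
  refine Measure.pi_eq fun s hs => ?_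
  rw [withDensity_apply _ (MeasurableSet.univ_pi hs), ← lintegral_indicator
    (MeasurableSet.univ_pi hs)]
  have h : ∀ x, (Set.univ.pi s).indicator (fun x => ∏ i, g i (x i)) x =
      ∏ i, (s i).indicator (g i) (x i) := fun x => by
    by_cases hx : ∀ i, x i ∈ s i
    · rw [Set.indicator_of_mem (by simpa using hx)]
      exact Finset.prod_congr rfl fun i _ => (Set.indicator_of_mem (hx i) _).symm
    · rw [Set.indicator_of_notMem (by simpa using hx)]
      obtain ⟨i, hi⟩ := not_forall.1 hx
      exact (Finset.prod_eq_zero (Finset.mem_univ i) (Set.indicator_of_notMem hi _)).symm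
  simp_rw [h]
  rw [lintegral_fin_pi_prod μ fun i => (hg i).indicator (hs i)]
  refine Finset.prod_congr rfl fun i _ => ?_
  rw [lintegral_indicator (hs i), withDensity_apply _ (hs i)]

theorem pi_eq_withDensity_rnDeriv (ν μ : ∀ i, Measure (X i)) [∀ i, IsProbabilityMeasure (ν i)]
    [∀ i, SigmaFinite (μ i)] (hac : ∀ i, ν i ≪ μ i) :
    Measure.pi ν = (Measure.pi μ).withDensity fun x => ∏ i, (ν i).rnDeriv (μ i) (x i) := by
  have h : ∀ i, (μ i).withDensity ((ν i).rnDeriv (μ i)) = ν i := fun i =>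
    Measure.withDensity_rnDeriv_eq _ _ (hac i)
  have : ∀ i, SigmaFinite ((μ i).withDensity ((ν i).rnDeriv (μ i))) := fun i => by
    rw [h i]; infer_instance
  rw [← pi_withDensity μ fun i => Measure.measurable_rnDeriv _ _]
  simp_rw [h]

theorem ae_pi_of_ae {ν : ∀ i, Measure (X i)} [∀ i, SigmaFinite (ν i)] (i : Fin d)
    {P : X i → Prop} (h : ∀ᵐ x ∂(ν i), P x) : ∀ᵐ x ∂(Measure.pi ν), P (x i) :=
  Measure.tendsto_eval_ae_ae.eventually h

theorem llr_pi (ν μ : ∀ i, Measure (X i)) [∀ i, IsProbabilityMeasure (ν i)]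
    [∀ i, SigmaFinite (μ i)] (hac : ∀ i, ν i ≪ μ i) :
    llr (Measure.pi ν) (Measure.pi μ) =ᵐ[Measure.pi ν] fun x => ∑ i, llr (ν i) (μ i) (x i) := by
  have hpi := pi_eq_withDensity_rnDeriv ν μ hac
  have hac' : Measure.pi ν ≪ Measure.pi μ := by
    rw [hpi]; exact withDensity_absolutelyContinuous _ _
  have h1 : (Measure.pi ν).rnDeriv (Measure.pi μ) =ᵐ[Measure.pi ν]
      fun x => ∏ i, (ν i).rnDeriv (μ i) (x i) := by
    refine hac'.ae_le ?_
    rw [hpi]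
    exact Measure.rnDeriv_withDensity _ (Finset.measurable_prod _ fun i _ =>
      (Measure.measurable_rnDeriv _ _).comp (measurable_pi_apply i))
  have h2 : ∀ᵐ x ∂(Measure.pi ν), ∀ i, 0 < (ν i).rnDeriv (μ i) (x i) :=
    ae_all_iff.2 fun i => ae_pi_of_ae i (Measure.rnDeriv_pos (hac i))
  have h3 : ∀ᵐ x ∂(Measure.pi ν), ∀ i, (ν i).rnDeriv (μ i) (x i) < ∞ :=
    ae_all_iff.2 fun i => ae_pi_of_ae i ((hac i).ae_le (Measure.rnDeriv_lt_top _ _))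
  filter_upwards [h1, h2, h3] with x hx hx2 hx3
  rw [llr, hx, ENNReal.toReal_prod, Real.log_prod]
  · rfl
  · exact fun i _ => (ENNReal.toReal_pos (hx2 i).ne' (hx3 i).ne).ne'

theorem isProbabilityMeasure_update {ν : ∀ i, Measure (X i)} [∀ i, IsProbabilityMeasure (ν i)]
    (i : Fin d) (τ : Measure (X i)) [IsProbabilityMeasure τ] (j : Fin d) :
    IsProbabilityMeasure (Function.update ν i τ j) := by
  rcases eq_or_ne j i with rfl | h
  · simpa using ‹IsProbabilityMeasure τ›
  · rw [Function.update_of_ne h]; infer_instance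

theorem measurable_update_prod (i : Fin d) :
    Measurable fun z : X i × (∀ j, X j) => Function.update z.2 i z.1 := by
  refine measurable_pi_lambda _ fun j => ?_
  rcases eq_or_ne j i with rfl | h
  · simpa using measurable_fst
  · simpa [Function.update_of_ne h, Function.comp_def] using
      (measurable_pi_apply j).comp (measurable_snd (α := X i) (β := ∀ j, X j))

/-- Overwriting one independent coordinate. -/
theorem measurePreserving_update (ν : ∀ i, Measure (X i)) [∀ i, IsProbabilityMeasure (ν i)]
    (i : Fin d) (τ : Measure (X i)) [IsProbabilityMeasure τ] :
    MeasurePreserving (fun z : X i × (∀ j, X j) => Function.update z.2 i z.1)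
      (τ.prod (Measure.pi ν)) (Measure.pi (Function.update ν i τ)) := by
  refine ⟨measurable_update_prod i, ?_⟩
  have := isProbabilityMeasure_update (ν := ν) i τ
  refine (Measure.pi_eq fun s hs => ?_).symm
  rw [Measure.map_apply (measurable_update_prod i) (MeasurableSet.univ_pi hs)]
  have h : (fun z : X i × (∀ j, X j) => Function.update z.2 i z.1) ⁻¹' Set.univ.pi s =
      s i ×ˢ Set.univ.pi (Function.update s i Set.univ) := by
    ext z
    simp only [Set.mem_preimage, Set.mem_univ_pi, Set.mem_prod]
    constructor
    · refine fun h => ⟨by simpa using h i, fun j => ?_⟩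
      rcases eq_or_ne j i with rfl | hj
      · simp
      · simpa [Function.update_of_ne hj] using h j
    · rintro ⟨h1, h2⟩ j
      rcases eq_or_ne j i with rfl | hj
      · simpa using h1
      · simpa [Function.update_of_ne hj] using h2 j
  rw [h, Measure.prod_prod, Measure.pi_pi, ← Finset.mul_prod_erase _ _ (Finset.mem_univ i),
    ← Finset.mul_prod_erase Finset.univ (fun j => Function.update ν i τ j (s j))
      (Finset.mem_univ i)]
  simp only [Function.update_self, measure_univ, one_mul]
  congr 1
  refine Finset.prod_congr rfl fun j hj => ?_
  rw [Function.update_of_ne (Finset.ne_of_mem_erase hj),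
    Function.update_of_ne (Finset.ne_of_mem_erase hj)]

theorem integrable_eval {ν : ∀ i, Measure (X i)} [∀ i, IsProbabilityMeasure (ν i)] (i : Fin d)
    {F : Type*} [NormedAddCommGroup F] {f : X i → F} (hf : Integrable f (ν i)) :
    Integrable (fun x : ∀ j, X j => f (x i)) (Measure.pi ν) :=
  (measurePreserving_eval ν i).integrable_comp_of_integrable hf

theorem integral_eval {ν : ∀ i, Measure (X i)} [∀ i, IsProbabilityMeasure (ν i)] (i : Fin d)
    {f : X i → ℝ} (hf : AEStronglyMeasurable f (ν i)) :
    ∫ x, f (x i) ∂(Measure.pi ν) = ∫ x, f x ∂(ν i) := by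
  have h := measurePreserving_eval ν i
  rw [← h.map_eq, integral_map h.measurable.aemeasurable (by rwa [h.map_eq])]

/-- If a sum of functions of independent variables is integrable, so is each summand. -/
theorem integrable_of_integrable_sum {ν : ∀ i, Measure (X i)} [∀ i, IsProbabilityMeasure (ν i)]
    {f : ∀ i, X i → ℝ}
    (h : Integrable (fun x : ∀ j, X j => ∑ i, f i (x i)) (Measure.pi ν)) (i : Fin d) :
    Integrable (f i) (ν i) := by
  have hupd := measurePreserving_update ν i (ν i)
  rw [Function.update_eq_self] at hupd
  have h1 := (hupd.integrable_comp h.aestronglyMeasurable).2 h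
  -- Freeze the other coordinates at one point with integrable slice; the other summands become a
  -- constant.
  obtain ⟨y, hy⟩ := (h1.prod_left_ae).exists
  refine (hy.sub (integrable_const (∑ j ∈ Finset.univ.erase i, f j (y j)))).congr
    (Filter.Eventually.of_forall fun x => ?_)
  simp only [Function.comp_apply, Pi.sub_apply]
  rw [← Finset.add_sum_erase _ _ (Finset.mem_univ i), Function.update_self,
    Finset.sum_congr rfl fun j hj => by rw [Function.update_of_ne (Finset.ne_of_mem_erase hj)]]
  ring

end Pi

end CAVI

/-! ### The Euclidean norm on blocks, and Wasserstein estimates. -/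

namespace CAVI

variable {d : ℕ} {k : Fin d → ℕ}

section EuclNorm

theorem euclNorm_eq_norm (x : Blocks k) : euclNorm x = ‖WithLp.toLp 2 x‖ := by
  rw [PiLp.norm_eq_of_L2]; rfl

theorem euclNorm_nonneg (x : Blocks k) : 0 ≤ euclNorm x := Real.sqrt_nonneg _

theorem euclNorm_sq (x : Blocks k) : euclNorm x ^ 2 = ∑ i, ‖x i‖ ^ 2 :=
  Real.sq_sqrt (Finset.sum_nonneg fun _ _ => sq_nonneg _)

@[fun_prop]
theorem continuous_euclNorm : Continuous (euclNorm : Blocks k → ℝ) := by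
  unfold euclNorm; fun_prop

@[fun_prop]
theorem measurable_euclNorm : Measurable (euclNorm : Blocks k → ℝ) :=
  continuous_euclNorm.measurable

theorem norm_apply_le_euclNorm (x : Blocks k) (i : Fin d) : ‖x i‖ ≤ euclNorm x := by
  refine Real.le_sqrt_of_sq_le ?_
  exact Finset.single_le_sum (f := fun j => ‖x j‖ ^ 2) (fun _ _ => sq_nonneg _)
    (Finset.mem_univ i)

theorem norm_le_euclNorm (x : Blocks k) : ‖x‖ ≤ euclNorm x :=
  (pi_norm_le_iff_of_nonneg (euclNorm_nonneg x)).2 (norm_apply_le_euclNorm x)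

theorem euclNorm_le_sum (x : Blocks k) : euclNorm x ≤ ∑ i, ‖x i‖ := by
  refine Real.sqrt_le_iff.2 ⟨Finset.sum_nonneg fun _ _ => norm_nonneg _, ?_⟩
  exact Finset.sum_sq_le_sq_sum_of_nonneg fun _ _ => norm_nonneg _

theorem sum_norm_le (x : Blocks k) : ∑ i, ‖x i‖ ≤ √d * euclNorm x := by
  rw [euclNorm, ← Real.sqrt_mul (Nat.cast_nonneg d)]
  refine Real.le_sqrt_of_sq_le ?_
  simpa using sq_sum_le_card_mul_sum_sq (s := Finset.univ) (f := fun i => ‖x i‖)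

theorem euclNorm_le_mul_norm (x : Blocks k) : euclNorm x ≤ d * ‖x‖ := by
  refine (euclNorm_le_sum x).trans ((Finset.sum_le_sum fun i _ => norm_le_pi_norm x i).trans ?_)
  simp

theorem euclNorm_sub_sq_le (x y z : Blocks k) :
    euclNorm (x - y) ^ 2 ≤ 2 * euclNorm (x - z) ^ 2 + 2 * euclNorm (y - z) ^ 2 := by
  simp only [euclNorm_eq_norm, WithLp.toLp_sub]
  set a := WithLp.toLp 2 x
  set b := WithLp.toLp 2 y
  set c := WithLp.toLp 2 z
  have h : ‖a - b‖ ≤ ‖a - c‖ + ‖b - c‖ := by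
    rw [norm_sub_rev b c]; exact norm_sub_le_norm_sub_add_norm_sub a c b
  nlinarith [norm_nonneg (a - b), sq_nonneg (‖a - c‖ - ‖b - c‖)]

end EuclNorm

section Wasserstein

/-- The transport cost of a coupling. -/
noncomputable def cost (π : Measure (Blocks k × Blocks k)) : ℝ≥0∞ :=
  ∫⁻ z, ENNReal.ofReal (euclNorm (z.1 - z.2) ^ 2) ∂π

theorem W2_sq (μ ν : Measure (Blocks k)) : W2 μ ν ^ 2 = ⨅ π ∈ couplings μ ν, cost π := by
  rw [W2, ← ENNReal.rpow_natCast, ← ENNReal.rpow_mul]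
  norm_num [cost]

theorem W2_le_of_sq_le {μ ν : Measure (Blocks k)} {a : ℝ} (ha : 0 ≤ a)
    (h : W2 μ ν ^ 2 ≤ ENNReal.ofReal (a ^ 2)) : W2 μ ν ≤ ENNReal.ofReal a := by
  rw [ENNReal.ofReal_pow ha] at h
  exact (ENNReal.pow_le_pow_left_iff two_ne_zero).1 h

theorem ofReal_sq_sub_le (x y z : Blocks k) :
    ENNReal.ofReal (euclNorm (x - y) ^ 2) ≤ 2 * ENNReal.ofReal (euclNorm (x - z) ^ 2)
      + 2 * ENNReal.ofReal (euclNorm (y - z) ^ 2) := by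
  have h2 : ∀ a : ℝ, 2 * ENNReal.ofReal a = ENNReal.ofReal (2 * a) := fun a => by
    rw [ENNReal.ofReal_mul (by norm_num), ENNReal.ofReal_ofNat]
  rw [h2, h2, ← ENNReal.ofReal_add (by positivity) (by positivity)]
  exact ENNReal.ofReal_le_ofReal (euclNorm_sub_sq_le x y z)

/-- The independent coupling and `|x - y|² ≤ 2|x|² + 2|y|²`. -/
theorem W2_sq_le_moments (μ ν : Measure (Blocks k)) [IsProbabilityMeasure μ]
    [IsProbabilityMeasure ν] :
    W2 μ ν ^ 2 ≤ 2 * ∫⁻ x, ENNReal.ofReal (euclNorm x ^ 2) ∂μ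
      + 2 * ∫⁻ x, ENNReal.ofReal (euclNorm x ^ 2) ∂ν := by
  have hm : Measurable fun x : Blocks k => ENNReal.ofReal (euclNorm x ^ 2) := by fun_prop
  rw [W2_sq]
  refine (iInf₂_le (μ.prod ν) ⟨inferInstance, by simp, by simp⟩).trans ?_
  calc cost (μ.prod ν)
      ≤ ∫⁻ z, (2 * ENNReal.ofReal (euclNorm z.1 ^ 2) + 2 * ENNReal.ofReal (euclNorm z.2 ^ 2))
          ∂(μ.prod ν) := lintegral_mono fun z => by
        simpa using ofReal_sq_sub_le z.1 z.2 0
    _ = _ := by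
        rw [lintegral_add_left (by fun_prop), lintegral_const_mul _ (by fun_prop),
          lintegral_const_mul _ (by fun_prop)]
        congr 2
        · rw [lintegral_prod _ (by fun_prop)]; simp
        · rw [lintegral_prod _ (by fun_prop)]; simp

open scoped ProbabilityTheory in
/-- Two couplings with a common second marginal can be glued along it. -/
theorem exists_gluing {X Y Z : Type*} [MeasurableSpace X] [MeasurableSpace Y] [MeasurableSpace Z]
    [StandardBorelSpace X] [StandardBorelSpace Z] [Nonempty X] [Nonempty Z]
    (π₁ : Measure (X × Y)) (π₂ : Measure (Z × Y)) [IsProbabilityMeasure π₁]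
    [IsProbabilityMeasure π₂] (h : π₁.map Prod.snd = π₂.map Prod.snd) :
    ∃ γ : Measure (Y × X × Z), IsProbabilityMeasure γ ∧
      γ.map (fun w => (w.2.1, w.1)) = π₁ ∧ γ.map (fun w => (w.2.2, w.1)) = π₂ := by
  have hp₁ : IsProbabilityMeasure (π₁.map Prod.swap) :=
    Measure.isProbabilityMeasure_map measurable_swap.aemeasurable
  have hp₂ : IsProbabilityMeasure (π₂.map Prod.swap) :=
    Measure.isProbabilityMeasure_map measurable_swap.aemeasurable
  set σ₁ := π₁.map Prod.swap
  set σ₂ := π₂.map Prod.swap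
  have hf : σ₁.fst = σ₂.fst := by
    simp only [σ₁, σ₂, Measure.fst, Measure.map_map measurable_fst measurable_swap]
    exact h
  have e₁ : σ₁.fst ⊗ₘ σ₁.condKernel = σ₁ := σ₁.disintegrate _
  have e₂ : σ₁.fst ⊗ₘ σ₂.condKernel = σ₂ := by rw [hf]; exact σ₂.disintegrate _
  have hs₁ : σ₁.map Prod.swap = π₁ := by
    rw [Measure.map_map measurable_swap measurable_swap]; simp
  have hs₂ : σ₂.map Prod.swap = π₂ := by
    rw [Measure.map_map measurable_swap measurable_swap]; simp
  -- Given the common coordinate, the two others are drawn independently from their conditional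
  -- laws.
  refine ⟨σ₁.fst ⊗ₘ (σ₁.condKernel.prod σ₂.condKernel), inferInstance, ?_, ?_⟩
  · conv_rhs => rw [← hs₁, ← e₁]
    ext s hs
    have hs' := measurable_swap hs
    rw [Measure.map_apply (by fun_prop) hs, Measure.map_apply measurable_swap hs,
      Measure.compProd_apply hs', Measure.compProd_apply ((by fun_prop :
        Measurable fun w : Y × X × Z => (w.2.1, w.1)) hs)]
    refine lintegral_congr fun y => ?_
    rw [ProbabilityTheory.Kernel.prod_apply]
    have : Prod.mk y ⁻¹' ((fun w : Y × X × Z => (w.2.1, w.1)) ⁻¹' s) =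
      (Prod.mk y ⁻¹' (Prod.swap ⁻¹' s)) ×ˢ (Set.univ : Set Z) := by ext; simp
    rw [this, Measure.prod_prod]; simp
  · conv_rhs => rw [← hs₂, ← e₂]
    ext s hs
    have hs' := measurable_swap hs
    rw [Measure.map_apply (by fun_prop) hs, Measure.map_apply measurable_swap hs,
      Measure.compProd_apply hs', Measure.compProd_apply ((by fun_prop :
        Measurable fun w : Y × X × Z => (w.2.2, w.1)) hs)]
    refine lintegral_congr fun y => ?_
    rw [ProbabilityTheory.Kernel.prod_apply]
    have : Prod.mk y ⁻¹' ((fun w : Y × X × Z => (w.2.2, w.1)) ⁻¹' s) =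
      (Set.univ : Set X) ×ˢ (Prod.mk y ⁻¹' (Prod.swap ⁻¹' s)) := by ext; simp
    rw [this, Measure.prod_prod]; simp

/-- Gluing arbitrary couplings before taking infima gives this weak triangle inequality without
optimal couplings. -/
theorem W2_sq_le_of_common (μ ν ρ : Measure (Blocks k)) :
    W2 μ ν ^ 2 ≤ 2 * W2 μ ρ ^ 2 + 2 * W2 ν ρ ^ 2 := by
  simp only [W2_sq, ENNReal.mul_iInf_of_ne two_ne_zero ENNReal.ofNat_ne_top]
  simp only [ENNReal.iInf_add, ENNReal.add_iInf]
  refine le_iInf₂ fun π₂ h₂ => le_iInf₂ fun π₁ h₁ => ?_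
  obtain ⟨hp₁, h₁f, h₁s⟩ := h₁
  obtain ⟨hp₂, h₂f, h₂s⟩ := h₂
  obtain ⟨γ, hγ, hγ₁, hγ₂⟩ := exists_gluing π₁ π₂ (h₁s.trans h₂s.symm)
  have hc : IsProbabilityMeasure (γ.map Prod.snd) :=
    Measure.isProbabilityMeasure_map measurable_snd.aemeasurable
  have hmem : γ.map Prod.snd ∈ couplings μ ν := by
    refine ⟨hc, ?_, ?_⟩
    · rw [← h₁f, ← hγ₁, Measure.map_map measurable_fst measurable_snd,
        Measure.map_map measurable_fst (by fun_prop)]; rfl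
    · rw [← h₂f, ← hγ₂, Measure.map_map measurable_snd measurable_snd,
        Measure.map_map measurable_fst (by fun_prop)]; rfl
  refine (iInf₂_le (γ.map Prod.snd) hmem).trans ?_
  have hm : Measurable fun z : Blocks k × Blocks k =>
      ENNReal.ofReal (euclNorm (z.1 - z.2) ^ 2) := by fun_prop
  rw [← hγ₁, ← hγ₂]
  simp only [cost]
  rw [lintegral_map hm measurable_snd, lintegral_map hm (by fun_prop),
    lintegral_map hm (by fun_prop), ← lintegral_const_mul _ (by fun_prop),
    ← lintegral_const_mul _ (by fun_prop), ← lintegral_add_left (by fun_prop)]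
  exact lintegral_mono fun w => by
    simpa [add_comm] using ofReal_sq_sub_le w.2.1 w.2.2 w.1

end Wasserstein

end CAVI

/-! ### Confining potentials and the entropy of product measures. -/

namespace CAVI

variable {d : ℕ} {k : Fin d → ℕ}

/-- A continuous normalized potential with an explicit linear lower bound. -/
structure IsConfining (ψ : Blocks k → ℝ) (α β : ℝ) : Prop where
  cont : Continuous ψ
  pos : 0 < β
  lower : ∀ x, α + β * euclNorm x ≤ ψ x
  norm : ∫⁻ x, ENNReal.ofReal (Real.exp (-ψ x)) = 1

/-- A measure with a Lebesgue density of finite differential entropy. -/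
def HasEntropy {E : Type*} [MeasureSpace E] (τ : Measure E) : Prop :=
  τ ≪ volume ∧ Integrable (llr τ volume) τ

/-- The (negative) differential entropy. -/
noncomputable def ent {E : Type*} [MeasureSpace E] (τ : Measure E) : ℝ :=
  ∫ x, llr τ volume x ∂τ

theorem integrable_of_norm_le_euclNorm {F : Type*} [NormedAddCommGroup F] {f : Blocks k → F}
    (hf : AEStronglyMeasurable f) {C q b : ℝ} (hC : 0 ≤ C) (hq : 0 ≤ q) (hb : 0 < b)
    (h : ∀ x, ‖f x‖ ≤ C * (euclNorm x ^ q * Real.exp (-(b * euclNorm x)))) : Integrable f := by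
  obtain ⟨K, hK0, hK⟩ := rpow_mul_exp_neg_le hq hb
  refine integrable_of_norm_le_exp volume hf (mul_nonneg hC hK0) (half_pos hb) fun x => ?_
  calc ‖f x‖ ≤ C * (euclNorm x ^ q * Real.exp (-(b * euclNorm x))) := h x
    _ ≤ C * (K * Real.exp (-(b / 2 * euclNorm x))) :=
        mul_le_mul_of_nonneg_left (hK _ (euclNorm_nonneg x)) hC
    _ ≤ C * (K * Real.exp (-(b / 2 * ‖x‖))) := by
        have := norm_le_euclNorm x
        gcongr
    _ = _ := by ring

namespace IsConfining

variable {ψ : Blocks k → ℝ} {α β : ℝ}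

theorem lower_const (h : IsConfining ψ α β) (x : Blocks k) : α ≤ ψ x := by
  nlinarith [h.lower x, h.pos, euclNorm_nonneg x]

theorem integrable_exp (h : IsConfining ψ α β) : Integrable fun x => Real.exp (-ψ x) := by
  have := h.cont
  refine (lintegral_ofReal_ne_top_iff_integrable (by fun_prop)
    (Filter.Eventually.of_forall fun x => (Real.exp_pos _).le)).1 ?_
  rw [h.norm]; simp

theorem integral_exp (h : IsConfining ψ α β) : ∫ x, Real.exp (-ψ x) = 1 := by
  rw [integral_eq_lintegral_of_nonneg_ae
    (Filter.Eventually.of_forall fun x => (Real.exp_pos _).le) h.integrable_exp.1, h.norm]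
  simp

theorem target_eq_tilted (h : IsConfining ψ α β) :
    target ψ = volume.tilted fun x => -ψ x := by
  simp [target, Measure.tilted, h.integral_exp]

theorem isProbabilityMeasure_target (h : IsConfining ψ α β) :
    IsProbabilityMeasure (target ψ) :=
  ⟨by rw [target, withDensity_apply _ MeasurableSet.univ, Measure.restrict_univ, h.norm]⟩

theorem volume_ac_target (h : IsConfining ψ α β) : volume ≪ target ψ := by
  rw [h.target_eq_tilted]; exact absolutelyContinuous_tilted h.integrable_exp

theorem target_ac_volume (h : IsConfining ψ α β) : target ψ ≪ volume := by
  rw [h.target_eq_tilted]; exact tilted_absolutelyContinuous _ _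

theorem integral_target (h : IsConfining ψ α β) (f : Blocks k → ℝ) :
    ∫ x, f x ∂(target ψ) = ∫ x, Real.exp (-ψ x) * f x := by
  rw [h.target_eq_tilted, integral_tilted, h.integral_exp]; simp

theorem integrable_target_iff (h : IsConfining ψ α β) (f : Blocks k → ℝ) :
    Integrable f (target ψ) ↔ Integrable fun x => Real.exp (-ψ x) * f x := by
  rw [h.target_eq_tilted, integrable_tilted_iff h.integrable_exp]; rfl

theorem llr_target (h : IsConfining ψ α β) {m : Measure (Blocks k)} [IsProbabilityMeasure m]
    (hm : m ≪ volume) : llr m (target ψ) =ᵐ[m] fun x => llr m volume x + ψ x := by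
  rw [h.target_eq_tilted]
  filter_upwards [llr_tilted_right hm h.integrable_exp] with x hx
  rw [hx, h.integral_exp]; simp [add_comm]

theorem integrable_exp_neg_half (h : IsConfining ψ α β) :
    Integrable fun x : Blocks k => Real.exp (-(β * euclNorm x + α) / 2) := by
  refine integrable_of_norm_le_euclNorm (by fun_prop) (Real.exp_pos (-α / 2)).le le_rfl
    (half_pos h.pos) fun x => ?_
  rw [Real.norm_eq_abs, abs_of_pos (Real.exp_pos _), Real.rpow_zero, one_mul, ← Real.exp_add]
  exact Real.exp_le_exp.2 (by linarith)

theorem integral_exp_neg_half_pos (h : IsConfining ψ α β) :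
    0 < ∫ x : Blocks k, Real.exp (-(β * euclNorm x + α) / 2) :=
  integral_exp_pos h.integrable_exp_neg_half

/-- Finite relative entropy controls the mean of the potential. -/
theorem integrable_potential_of_entropy_ne_top (h : IsConfining ψ α β) {m : Measure (Blocks k)}
    [IsProbabilityMeasure m] (hm : entropy ψ m ≠ ∞) :
    Integrable ψ m ∧ ∫ x, ψ x ∂m ≤ 2 * (entropy ψ m).toReal
      + 2 * Real.log (∫ x : Blocks k, Real.exp (-(β * euclNorm x + α) / 2)) := by
  have hc := h.cont
  have := h.isProbabilityMeasure_target
  have hbd : ∀ x, Real.exp (-ψ x) * Real.exp (ψ x / 2) ≤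
      Real.exp (-(β * euclNorm x + α) / 2) := fun x => by
    rw [← Real.exp_add]; exact Real.exp_le_exp.2 (by linarith [h.lower x])
  have hI : Integrable fun x => Real.exp (-ψ x) * Real.exp (ψ x / 2) :=
    h.integrable_exp_neg_half.mono' (by fun_prop) (Filter.Eventually.of_forall fun x => by
      rw [Real.norm_eq_abs, abs_of_pos (by positivity)]; exact hbd x)
  -- With test function `ψ / 2` the exponential moment under `ρ` is the Lebesgue integral of `exp
  -- (-ψ / 2)`, finite by the linear lower bound. The halving causes the factors `2` in the
  -- conclusion.
  obtain ⟨h1, h2⟩ := integrable_and_integral_le_klDiv_add_log (μ := m) (ρ := target ψ)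
    (φ := fun x => ψ x / 2) (by fun_prop) (C := α / 2) (fun x => by linarith [h.lower_const x])
    ((h.integrable_target_iff _).2 hI) hm
  have h3 : Integrable ψ m := by
    refine (h1.const_mul 2).congr (Filter.Eventually.of_forall fun x => ?_)
    simp only; ring
  refine ⟨h3, ?_⟩
  have h4 : Real.log (∫ x, Real.exp (ψ x / 2) ∂(target ψ)) ≤
      Real.log (∫ x : Blocks k, Real.exp (-(β * euclNorm x + α) / 2)) := by
    rw [h.integral_target]
    refine Real.log_le_log ?_ (integral_mono hI h.integrable_exp_neg_half hbd)
    have e : ∀ x, Real.exp (-ψ x) * Real.exp (ψ x / 2) = Real.exp (-ψ x + ψ x / 2) :=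
      fun x => (Real.exp_add _ _).symm
    simp_rw [e] at hI ⊢
    exact integral_exp_pos hI
  rw [integral_div] at h2
  have h5 : (entropy ψ m).toReal = (InformationTheory.klDiv m (target ψ)).toReal := rfl
  linarith

variable {ν : ∀ i, Measure (EuclideanSpace ℝ (Fin (k i)))} [∀ i, IsProbabilityMeasure (ν i)]

theorem llr_pi_volume (hac : ∀ i, ν i ≪ volume) :
    llr (Measure.pi ν) volume =ᵐ[Measure.pi ν] fun x => ∑ i, llr (ν i) volume (x i) :=
  llr_pi ν (fun _ => volume) hac

theorem pi_ac_volume (hac : ∀ i, ν i ≪ volume) : Measure.pi ν ≪ volume := by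
  rw [pi_eq_withDensity_rnDeriv ν (fun _ => volume) hac]
  exact withDensity_absolutelyContinuous _ _

/-- The log-density with respect to `ρ` is a sum of one-block log-densities plus `ψ`, each
integrable separately. -/
theorem entropy_pi (h : IsConfining ψ α β) (hν : ∀ i, HasEntropy (ν i))
    (hψ : Integrable ψ (Measure.pi ν)) :
    entropy ψ (Measure.pi ν) ≠ ∞ ∧
      (entropy ψ (Measure.pi ν)).toReal = ∑ i, ent (ν i) + ∫ x, ψ x ∂(Measure.pi ν) := by
  have := h.isProbabilityMeasure_target
  have hac := pi_ac_volume fun i => (hν i).1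
  have hac' := hac.trans h.volume_ac_target
  have hi : ∀ i ∈ Finset.univ, Integrable (fun x : Blocks k => llr (ν i) volume (x i))
      (Measure.pi ν) := fun i _ => integrable_eval i (hν i).2
  have hllr : llr (Measure.pi ν) (target ψ) =ᵐ[Measure.pi ν]
      fun x => ∑ i, llr (ν i) volume (x i) + ψ x := by
    filter_upwards [h.llr_target hac, llr_pi_volume fun i => (hν i).1] with x h1 h2
    rw [h1, h2]
  refine ⟨InformationTheory.klDiv_ne_top hac'
    (((integrable_finsetSum _ hi).add hψ).congr hllr.symm), ?_⟩
  rw [entropy, InformationTheory.toReal_klDiv_of_measure_eq hac' (by simp),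
    integral_congr_ae hllr, integral_add (integrable_finsetSum _ hi) hψ,
    integral_finsetSum _ hi]
  congr 1
  exact Finset.sum_congr rfl fun i _ => integral_eval i (hν i).2.1

/-- Finite entropy makes `ψ` integrable; subtracting it from the log-density leaves a sum of
functions of independent blocks, each of which is then integrable. This gives the minimizer its
regularity. -/
theorem hasEntropy_of_entropy_pi_ne_top (h : IsConfining ψ α β)
    (hν : entropy ψ (Measure.pi ν) ≠ ∞) (i : Fin d) : HasEntropy (ν i) := by
  have hψ := (h.integrable_potential_of_entropy_ne_top hν).1
  obtain ⟨h1, h2⟩ := InformationTheory.klDiv_ne_top_iff.1 hν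
  have hac : Measure.pi ν ≪ volume := h1.trans h.target_ac_volume
  have haci : ∀ j, ν j ≪ volume := fun j => by
    rw [← (measurePreserving_eval ν j).map_eq]
    exact (hac.map (measurable_pi_apply j)).trans
      (Measure.quasiMeasurePreserving_eval (fun i => (volume :
        Measure (EuclideanSpace ℝ (Fin (k i))))) j).absolutelyContinuous
  refine ⟨haci i, integrable_of_integrable_sum (f := fun j => llr (ν j) volume) ?_ i⟩
  refine (h2.sub hψ).congr ?_
  filter_upwards [h.llr_target hac, llr_pi_volume haci] with x e1 e2
  simp only [Pi.sub_apply]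
  rw [e1, e2]; ring

end IsConfining

end CAVI

/-! ### The Gibbs measure of one block and its variational principle. -/

namespace CAVI

theorem ac_restrict_of_ae_mem {X : Type*} [MeasurableSpace X] {σ μ : Measure X} {D : Set X}
    (hac : σ ≪ μ) (h : ∀ᵐ x ∂σ, x ∈ D) : σ ≪ μ.restrict D := by
  rw [← Measure.restrict_eq_self_of_ae_mem h]
  exact hac.restrict D

/-- Needed because `gibbs` is a tilt of Lebesgue measure restricted to `finiteSet`, whereas
entropies refer to the full Lebesgue measure. -/
theorem llr_restrict {X : Type*} [MeasurableSpace X] {σ μ : Measure X} [IsFiniteMeasure σ]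
    [SigmaFinite μ] {D : Set X} (hD : MeasurableSet D) (hac : σ ≪ μ) (h : ∀ᵐ x ∂σ, x ∈ D) :
    llr σ (μ.restrict D) =ᵐ[σ] llr σ μ := by
  have hac' := ac_restrict_of_ae_mem hac h
  have e : σ = (μ.restrict D).withDensity (σ.rnDeriv μ) := by
    rw [← restrict_withDensity hD, Measure.withDensity_rnDeriv_eq _ _ hac,
      Measure.restrict_eq_self_of_ae_mem h]
  have h1 : σ.rnDeriv (μ.restrict D) =ᵐ[μ.restrict D] σ.rnDeriv μ := by
    have := Measure.rnDeriv_withDensity (μ.restrict D) (Measure.measurable_rnDeriv σ μ)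
    rwa [← e] at this
  filter_upwards [hac'.ae_le h1] with x hx
  simp only [llr, hx]

variable {d : ℕ} {k : Fin d → ℕ}

/-- The points of block `i` at which the averaged potential is finite. -/
def finiteSet (ψ : Blocks k → ℝ) (ν : ∀ i, Measure (EuclideanSpace ℝ (Fin (k i)))) (i : Fin d) :
    Set (EuclideanSpace ℝ (Fin (k i))) :=
  {x | Integrable (fun y => ψ (Function.update y i x)) (Measure.pi ν)}

/-- The normalizing constant of the optimal block measure. -/
noncomputable def partitionFn (ψ : Blocks k → ℝ)
    (ν : ∀ i, Measure (EuclideanSpace ℝ (Fin (k i)))) (i : Fin d) : ℝ :=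
  ∫ x in finiteSet ψ ν i, Real.exp (-potential ψ ν i x)

/-- The optimal measure of block `i`, given the measures of the other blocks. -/
noncomputable def gibbs (ψ : Blocks k → ℝ)
    (ν : ∀ i, Measure (EuclideanSpace ℝ (Fin (k i)))) (i : Fin d) :
    Measure (EuclideanSpace ℝ (Fin (k i))) :=
  (volume.restrict (finiteSet ψ ν i)).tilted fun x => -potential ψ ν i x

theorem gibbs_ac_restrict {ψ : Blocks k → ℝ} {ν : ∀ i, Measure (EuclideanSpace ℝ (Fin (k i)))}
    {i : Fin d} : gibbs ψ ν i ≪ volume.restrict (finiteSet ψ ν i) :=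
  tilted_absolutelyContinuous _ _

theorem gibbs_ac {ψ : Blocks k → ℝ} {ν : ∀ i, Measure (EuclideanSpace ℝ (Fin (k i)))}
    {i : Fin d} : gibbs ψ ν i ≪ volume :=
  gibbs_ac_restrict.trans Measure.absolutelyContinuous_restrict

namespace IsConfining

variable {ψ : Blocks k → ℝ} {α β : ℝ}
  {ν : ∀ i, Measure (EuclideanSpace ℝ (Fin (k i)))} [∀ i, IsProbabilityMeasure (ν i)] {i : Fin d}

theorem measurable_comp_update (h : IsConfining ψ α β) (i : Fin d) :
    StronglyMeasurable (Function.uncurry fun (x : EuclideanSpace ℝ (Fin (k i))) y =>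
      ψ (Function.update y i x)) :=
  (h.cont.measurable.comp (measurable_update_prod i)).stronglyMeasurable

theorem measurableSet_finiteSet (h : IsConfining ψ α β) : MeasurableSet (finiteSet ψ ν i) :=
  measurableSet_integrable (h.measurable_comp_update i)

theorem measurable_potential (h : IsConfining ψ α β) : Measurable (potential ψ ν i) :=
  ((h.measurable_comp_update i).integral_prod_right (ν := Measure.pi ν)).measurable

theorem lower_update (h : IsConfining ψ α β) (x : EuclideanSpace ℝ (Fin (k i))) (y : Blocks k) :
    α + β * ‖x‖ ≤ ψ (Function.update y i x) := by
  have h1 := norm_apply_le_euclNorm (Function.update y i x) i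
  rw [Function.update_self] at h1
  have := mul_le_mul_of_nonneg_left h1 h.pos.le
  linarith [h.lower (Function.update y i x)]

theorem lower_potential (h : IsConfining ψ α β) {x : EuclideanSpace ℝ (Fin (k i))}
    (hx : x ∈ finiteSet ψ ν i) : α + β * ‖x‖ ≤ potential ψ ν i x := by
  have := integral_mono (integrable_const (α + β * ‖x‖)) hx fun y => h.lower_update x y
  simpa [potential] using this

theorem exp_neg_potential_le (h : IsConfining ψ α β) {x : EuclideanSpace ℝ (Fin (k i))}
    (hx : x ∈ finiteSet ψ ν i) :
    Real.exp (-potential ψ ν i x) ≤ Real.exp (-α) * Real.exp (-(β * ‖x‖)) := by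
  rw [← Real.exp_add]; exact Real.exp_le_exp.2 (by linarith [h.lower_potential hx])

theorem integrable_exp_potential (h : IsConfining ψ α β) :
    Integrable (fun x => Real.exp (-potential ψ ν i x))
      (volume.restrict (finiteSet ψ ν i)) := by
  have hm := h.measurable_potential (ν := ν) (i := i)
  refine (((integrable_exp_neg_mul_norm volume h.pos).const_mul
    (Real.exp (-α))).integrableOn (s := finiteSet ψ ν i)).mono' (by fun_prop) ?_
  filter_upwards [ae_restrict_mem h.measurableSet_finiteSet] with x hx
  rw [Real.norm_eq_abs, abs_of_pos (Real.exp_pos _)]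
  exact h.exp_neg_potential_le hx

theorem isProbabilityMeasure_gibbs (h : IsConfining ψ α β) (hD : volume (finiteSet ψ ν i) ≠ 0) :
    IsProbabilityMeasure (gibbs ψ ν i) := by
  have : NeZero (volume.restrict (finiteSet ψ ν i)) := ⟨by simpa using hD⟩
  exact isProbabilityMeasure_tilted h.integrable_exp_potential

theorem ae_mem_gibbs (h : IsConfining ψ α β) : ∀ᵐ x ∂(gibbs ψ ν i), x ∈ finiteSet ψ ν i :=
  gibbs_ac_restrict.ae_le (ae_restrict_mem h.measurableSet_finiteSet)

theorem llr_gibbs (h : IsConfining ψ α β) (hD : volume (finiteSet ψ ν i) ≠ 0) :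
    llr (gibbs ψ ν i) volume =ᵐ[gibbs ψ ν i]
      fun x => -potential ψ ν i x - Real.log (partitionFn ψ ν i) := by
  have := h.isProbabilityMeasure_gibbs hD
  have h1 := log_rnDeriv_tilted_left_self (h.integrable_exp_potential (ν := ν) (i := i))
  filter_upwards [llr_restrict h.measurableSet_finiteSet gibbs_ac h.ae_mem_gibbs,
    gibbs_ac_restrict.ae_le h1] with x hx1 hx2
  rw [← hx1]
  exact hx2

/-- `|v|` is at most a multiple of `exp ((v - α) / 2)`, so half of the decay `exp (-v)` pays for it
and the other half still gives `exp (-(β / 2 * ‖x‖))`. -/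
theorem integrable_potential_gibbs (h : IsConfining ψ α β) :
    Integrable (potential ψ ν i) (gibbs ψ ν i) := by
  have hm := h.measurable_potential (ν := ν) (i := i)
  refine (integrable_tilted_iff h.integrable_exp_potential _).2 ?_
  refine (((integrable_exp_neg_mul_norm volume (half_pos h.pos)).const_mul
    (Real.exp (-α) * (|α| + 2))).integrableOn (s := finiteSet ψ ν i)).mono'
      (by fun_prop) ?_
  filter_upwards [ae_restrict_mem h.measurableSet_finiteSet] with x hx
  have hlow := h.lower_potential hx
  set v := potential ψ ν i x
  have hw : 0 ≤ v - α := by nlinarith [h.pos, norm_nonneg x]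
  have h1 : |v| ≤ (|α| + 2) * Real.exp ((v - α) / 2) := by
    have e1 := Real.add_one_le_exp ((v - α) / 2)
    have e2 : |v| ≤ |α| + (v - α) := by
      calc |v| = |α + (v - α)| := by ring_nf
        _ ≤ |α| + |v - α| := abs_add_le _ _
        _ = _ := by rw [abs_of_nonneg hw]
    nlinarith [abs_nonneg α]
  rw [norm_smul, Real.norm_eq_abs, Real.norm_eq_abs, abs_of_pos (Real.exp_pos _)]
  calc Real.exp (-v) * |v| ≤ Real.exp (-v) * ((|α| + 2) * Real.exp ((v - α) / 2)) := by gcongr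
    _ = (|α| + 2) * Real.exp (-v + (v - α) / 2) := by rw [Real.exp_add]; ring
    _ ≤ (|α| + 2) * Real.exp (-α + -(β / 2 * ‖x‖)) :=
        mul_le_mul_of_nonneg_left (Real.exp_le_exp.2 (by linarith)) (by positivity)
    _ = _ := by rw [Real.exp_add]; ring

/-- Tonelli for `ψ - α`: it is nonnegative, so the inner integral of its norm is just the potential
minus `α`. -/
theorem integrable_update_iff (h : IsConfining ψ α β)
    {τ : Measure (EuclideanSpace ℝ (Fin (k i)))} [IsProbabilityMeasure τ] :
    Integrable ψ (Measure.pi (Function.update ν i τ)) ↔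
      (∀ᵐ x ∂τ, x ∈ finiteSet ψ ν i) ∧ Integrable (potential ψ ν i) τ := by
  have hmp := measurePreserving_update ν i τ
  have hsm := (h.measurable_comp_update i).aestronglyMeasurable (μ := τ.prod (Measure.pi ν))
  have hsm' : AEStronglyMeasurable (fun z : EuclideanSpace ℝ (Fin (k i)) × Blocks k =>
      ψ (Function.update z.2 i z.1) - α) (τ.prod (Measure.pi ν)) :=
    hsm.sub aestronglyMeasurable_const
  rw [← hmp.integrable_comp h.cont.aestronglyMeasurable]
  have e1 : Integrable (ψ ∘ fun z : EuclideanSpace ℝ (Fin (k i)) × Blocks k =>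
      Function.update z.2 i z.1) (τ.prod (Measure.pi ν)) ↔
      Integrable (fun z : EuclideanSpace ℝ (Fin (k i)) × Blocks k =>
        ψ (Function.update z.2 i z.1) - α) (τ.prod (Measure.pi ν)) := by
    constructor
    · exact fun H => H.sub (integrable_const α)
    · intro H
      refine (H.add (integrable_const α)).congr (Filter.Eventually.of_forall fun z => ?_)
      simp
  have e2 : ∀ x, Integrable (fun y => ψ (Function.update y i x) - α) (Measure.pi ν) ↔
      x ∈ finiteSet ψ ν i := fun x => by
    constructor
    · intro H
      refine (H.add (integrable_const α)).congr (Filter.Eventually.of_forall fun z => ?_)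
      simp
    · exact fun H => H.sub (integrable_const α)
  rw [e1, integrable_prod_iff hsm']
  simp only [e2]
  refine and_congr_right fun hD => ?_
  have e3 : (fun x => ∫ y, ‖ψ (Function.update y i x) - α‖ ∂(Measure.pi ν)) =ᵐ[τ]
      fun x => potential ψ ν i x - α := by
    filter_upwards [hD] with x hx
    have : ∀ y, ‖ψ (Function.update y i x) - α‖ = ψ (Function.update y i x) - α := fun y =>
      Real.norm_of_nonneg (sub_nonneg.2 (h.lower_const _))
    simp_rw [this]
    rw [integral_sub hx (integrable_const α)]
    simp [potential]
  rw [integrable_congr e3]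
  constructor
  · intro H
    refine (H.add (integrable_const α)).congr (Filter.Eventually.of_forall fun z => ?_)
    simp
  · exact fun H => H.sub (integrable_const α)

theorem integral_update (h : IsConfining ψ α β)
    {τ : Measure (EuclideanSpace ℝ (Fin (k i)))} [IsProbabilityMeasure τ]
    (hτ : Integrable ψ (Measure.pi (Function.update ν i τ))) :
    ∫ x, ψ x ∂(Measure.pi (Function.update ν i τ)) = ∫ x, potential ψ ν i x ∂τ := by
  have hmp := measurePreserving_update ν i τ
  have hint := (hmp.integrable_comp h.cont.aestronglyMeasurable).2 hτ
  rw [← hmp.map_eq, integral_map hmp.measurable.aemeasurable h.cont.aestronglyMeasurable]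
  exact integral_prod _ hint

theorem hasEntropy_gibbs (h : IsConfining ψ α β) (hD : volume (finiteSet ψ ν i) ≠ 0) :
    HasEntropy (gibbs ψ ν i) := by
  have := h.isProbabilityMeasure_gibbs hD
  exact ⟨gibbs_ac, (h.integrable_potential_gibbs.neg.sub (integrable_const
    (Real.log (partitionFn ψ ν i)))).congr (h.llr_gibbs hD).symm⟩

theorem integrable_update_gibbs (h : IsConfining ψ α β) (hD : volume (finiteSet ψ ν i) ≠ 0) :
    Integrable ψ (Measure.pi (Function.update ν i (gibbs ψ ν i))) := by
  have := h.isProbabilityMeasure_gibbs hD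
  exact h.integrable_update_iff.2 ⟨h.ae_mem_gibbs, h.integrable_potential_gibbs⟩

/-- The optimal value of the one-block problem. Read backwards, it bounds `-log Z` by entropy and
mean potential after the update. -/
theorem ent_gibbs_add (h : IsConfining ψ α β) (hD : volume (finiteSet ψ ν i) ≠ 0) :
    ent (gibbs ψ ν i) + ∫ x, ψ x ∂(Measure.pi (Function.update ν i (gibbs ψ ν i))) =
      -Real.log (partitionFn ψ ν i) := by
  have := h.isProbabilityMeasure_gibbs hD
  have hi := h.integrable_potential_gibbs (ν := ν) (i := i)
  have hi' : Integrable (fun x => -potential ψ ν i x) (gibbs ψ ν i) := hi.neg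
  rw [h.integral_update (h.integrable_update_gibbs hD), ent, integral_congr_ae (h.llr_gibbs hD),
    integral_sub hi' (integrable_const _), integral_neg]
  simp only [integral_const, probReal_univ, one_smul]
  ring

theorem partitionFn_pos (h : IsConfining ψ α β) (hD : volume (finiteSet ψ ν i) ≠ 0) :
    0 < partitionFn ψ ν i := by
  have : NeZero (volume.restrict (finiteSet ψ ν i)) := ⟨by simpa using hD⟩
  exact integral_exp_pos h.integrable_exp_potential

/-- The linear lower bound on `ψ` survives averaging over the other blocks; this is the source of
exponential decay. -/
theorem rnDeriv_gibbs_le (h : IsConfining ψ α β) (hD : volume (finiteSet ψ ν i) ≠ 0) :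
    (gibbs ψ ν i).rnDeriv volume ≤ᵐ[volume] fun x =>
      ENNReal.ofReal (Real.exp (-Real.log (partitionFn ψ ν i) - α - β * ‖x‖)) := by
  have hm := h.measurable_potential (ν := ν) (i := i)
  have e : gibbs ψ ν i = volume.withDensity ((finiteSet ψ ν i).indicator fun x =>
      ENNReal.ofReal (Real.exp (-potential ψ ν i x) / partitionFn ψ ν i)) := by
    rw [withDensity_indicator h.measurableSet_finiteSet]; rfl
  have h1 := Measure.rnDeriv_withDensity volume (f := (finiteSet ψ ν i).indicator fun x =>
      ENNReal.ofReal (Real.exp (-potential ψ ν i x) / partitionFn ψ ν i))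
      (Measurable.indicator (by fun_prop) h.measurableSet_finiteSet)
  rw [← e] at h1
  filter_upwards [h1] with x hx
  rw [hx]
  by_cases hxD : x ∈ finiteSet ψ ν i
  · rw [Set.indicator_of_mem hxD]
    refine ENNReal.ofReal_le_ofReal ?_
    nth_rewrite 1 [← Real.exp_log (h.partitionFn_pos hD)]
    rw [← Real.exp_sub]
    exact Real.exp_le_exp.2 (by linarith [h.lower_potential hxD])
  · rw [Set.indicator_of_notMem hxD]; exact zero_le

/-- By Fubini `σ` is carried by `finiteSet`, which therefore cannot be a Lebesgue null set. -/
theorem volume_finiteSet_ne_zero (h : IsConfining ψ α β)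
    {σ : Measure (EuclideanSpace ℝ (Fin (k i)))} [IsProbabilityMeasure σ] (hσ : σ ≪ volume)
    (hψ : Integrable ψ (Measure.pi (Function.update ν i σ))) :
    volume (finiteSet ψ ν i) ≠ 0 := fun h0 => by
  have h1 := (h.integrable_update_iff.1 hψ).1
  have h2 : ∀ᵐ x ∂σ, x ∉ finiteSet ψ ν i := measure_eq_zero_iff_ae_notMem.1 (hσ h0)
  obtain ⟨x, hx1, hx2⟩ := (h1.and h2).exists
  exact hx2 hx1

/-- The Gibbs variational principle for one block. -/
theorem toReal_klDiv_gibbs (h : IsConfining ψ α β)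
    {σ : Measure (EuclideanSpace ℝ (Fin (k i)))} [IsProbabilityMeasure σ] (hσ : HasEntropy σ)
    (hψ : Integrable ψ (Measure.pi (Function.update ν i σ))) :
    InformationTheory.klDiv σ (gibbs ψ ν i) ≠ ∞ ∧
    (InformationTheory.klDiv σ (gibbs ψ ν i)).toReal =
      ent σ + ∫ x, ψ x ∂(Measure.pi (Function.update ν i σ))
        + Real.log (partitionFn ψ ν i) := by
  have hD := h.volume_finiteSet_ne_zero hσ.1 hψ
  have := h.isProbabilityMeasure_gibbs hD
  obtain ⟨hmem, hpot⟩ := h.integrable_update_iff.1 hψ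
  -- `σ` charges only points of finite potential, where the Gibbs density is positive.
  have hac := ac_restrict_of_ae_mem hσ.1 hmem
  have hac' : σ ≪ gibbs ψ ν i := hac.trans (absolutelyContinuous_tilted h.integrable_exp_potential)
  have hllr : llr σ (gibbs ψ ν i) =ᵐ[σ] fun x =>
      llr σ volume x + potential ψ ν i x + Real.log (partitionFn ψ ν i) := by
    filter_upwards [llr_tilted_right hac (h.integrable_exp_potential (ν := ν) (i := i)),
      llr_restrict h.measurableSet_finiteSet hσ.1 hmem] with x h1 h2
    rw [gibbs, h1, h2, partitionFn]; ring
  have hs : Integrable (fun x => llr σ volume x + potential ψ ν i x) σ := hσ.2.add hpot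
  refine ⟨InformationTheory.klDiv_ne_top hac'
    ((hs.add (integrable_const _)).congr hllr.symm), ?_⟩
  rw [InformationTheory.toReal_klDiv_of_measure_eq hac' (by simp), integral_congr_ae hllr,
    integral_add hs (integrable_const _), integral_add hσ.2 hpot, h.integral_update hψ, ent]
  simp

end IsConfining

end CAVI

/-! ### Entropy descent, and second moments from Gibbs marginals. -/

namespace CAVI

variable {d : ℕ} {k : Fin d → ℕ}

theorem sum_ent_update (ν : ∀ i, Measure (EuclideanSpace ℝ (Fin (k i)))) (i : Fin d)
    (τ : Measure (EuclideanSpace ℝ (Fin (k i)))) :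
    ∑ j, ent (Function.update ν i τ j) = ∑ j, ent (ν j) - ent (ν i) + ent τ := by
  rw [← Finset.add_sum_erase _ _ (Finset.mem_univ i),
    ← Finset.add_sum_erase _ (fun j => ent (ν j)) (Finset.mem_univ i), Function.update_self,
    Finset.sum_congr rfl fun j hj => by rw [Function.update_of_ne (Finset.ne_of_mem_erase hj)]]
  ring

theorem forall_update {P : ∀ i, Measure (EuclideanSpace ℝ (Fin (k i))) → Prop}
    {ν : ∀ i, Measure (EuclideanSpace ℝ (Fin (k i)))} (hν : ∀ i, P i (ν i)) {i : Fin d}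
    {τ : Measure (EuclideanSpace ℝ (Fin (k i)))} (hτ : P i τ) (j : Fin d) :
    P j (Function.update ν i τ j) := by
  rcases eq_or_ne j i with rfl | hj
  · simpa using hτ
  · rw [Function.update_of_ne hj]; exact hν j

namespace IsConfining

variable {ψ : Blocks k → ℝ} {α β : ℝ}
  {ν : ∀ i, Measure (EuclideanSpace ℝ (Fin (k i)))} [∀ i, IsProbabilityMeasure (ν i)] {i : Fin d}

/-- Optimizing one block does not increase the entropy. -/
theorem entropy_update_gibbs_le (h : IsConfining ψ α β) (hν : ∀ i, HasEntropy (ν i))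
    (hψ : Integrable ψ (Measure.pi ν)) (i : Fin d) :
    entropy ψ (Measure.pi (Function.update ν i (gibbs ψ ν i))) ≤ entropy ψ (Measure.pi ν) := by
  have hupd : Function.update ν i (ν i) = ν := Function.update_eq_self i ν
  have hψ' : Integrable ψ (Measure.pi (Function.update ν i (ν i))) := by rwa [hupd]
  have hD := h.volume_finiteSet_ne_zero (hν i).1 hψ'
  have := h.isProbabilityMeasure_gibbs hD
  have := isProbabilityMeasure_update (ν := ν) i (gibbs ψ ν i)
  obtain ⟨h1, h2⟩ := h.entropy_pi hν hψ
  obtain ⟨h3, h4⟩ := h.entropy_pi (ν := Function.update ν i (gibbs ψ ν i))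
    (forall_update hν (h.hasEntropy_gibbs hD)) (h.integrable_update_gibbs hD)
  rw [← ENNReal.toReal_le_toReal h3 h1, h2, h4, sum_ent_update]
  -- The decrease of entropy is exactly this relative entropy.
  have h5 := (h.toReal_klDiv_gibbs (hν i) hψ').2
  rw [hupd] at h5
  have h6 := h.ent_gibbs_add hD
  have h7 : 0 ≤ (InformationTheory.klDiv (ν i) (gibbs ψ ν i)).toReal := ENNReal.toReal_nonneg
  linarith

theorem integrable_sq_mul_exp (h : IsConfining ψ α β) :
    Integrable fun x : Blocks k => euclNorm x ^ 2 * Real.exp (-β * ∑ i, ‖x i‖) := by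
  refine integrable_of_norm_le_euclNorm (by fun_prop) zero_le_one zero_le_two h.pos fun x => ?_
  rw [Real.norm_eq_abs, abs_of_nonneg (by positivity), one_mul, Real.rpow_two]
  refine mul_le_mul_of_nonneg_left (Real.exp_le_exp.2 ?_) (sq_nonneg _)
  have := mul_le_mul_of_nonneg_left (euclNorm_le_sum x) h.pos.le
  linarith

/-- Second moment of a product measure whose marginals have exponentially decaying densities. -/
theorem lintegral_sq_le (h : IsConfining ψ α β) (hν : ∀ i, HasEntropy (ν i)) {H : ℝ}
    (hfin : entropy ψ (Measure.pi ν) ≠ ∞) (hH : (entropy ψ (Measure.pi ν)).toReal ≤ H)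
    {c : Fin d → ℝ} (hc : ∀ i, (ν i).rnDeriv volume ≤ᵐ[volume] fun x =>
      ENNReal.ofReal (Real.exp (c i - α - β * ‖x‖)))
    (hc' : ∀ i, c i ≤ ent (ν i) + (2 * H
      + 2 * Real.log (∫ x : Blocks k, Real.exp (-(β * euclNorm x + α) / 2)))) :
    ∫⁻ x, ENNReal.ofReal (euclNorm x ^ 2) ∂(Measure.pi ν) ≤ ENNReal.ofReal
      (Real.exp ((2 * d + 1) * H - (d + 1) * α)
        * (∫ x : Blocks k, Real.exp (-(β * euclNorm x + α) / 2)) ^ (2 * d)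
        * ∫ x : Blocks k, euclNorm x ^ 2 * Real.exp (-β * ∑ i, ‖x i‖)) := by
  set I := ∫ x : Blocks k, Real.exp (-(β * euclNorm x + α) / 2)
  have hI : 0 < I := h.integral_exp_neg_half_pos
  have hm : Measurable fun x : Blocks k => ∏ i, (ν i).rnDeriv volume (x i) :=
    Finset.measurable_prod _ fun i _ =>
      (Measure.measurable_rnDeriv _ _).comp (measurable_pi_apply i)
  have hae : ∀ᵐ x : Blocks k, ∀ i, (ν i).rnDeriv volume (x i) ≤
      ENNReal.ofReal (Real.exp (c i - α - β * ‖x i‖)) :=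
    ae_all_iff.2 fun i => ae_pi_of_ae (ν := fun i => (volume :
      Measure (EuclideanSpace ℝ (Fin (k i))))) i (hc i)
  -- The sum of the `c i` is at most the sum of the `ent (ν i)` plus `d * (2 * H + 2 * log I)`. The
  -- former sum equals the entropy minus the mean of `ψ`, hence is at most `H - α`.
  have hexp : Real.exp (∑ i, c i - d * α) ≤
      Real.exp ((2 * d + 1) * H - (d + 1) * α) * I ^ (2 * d) := by
    rw [← Real.exp_log (pow_pos hI (2 * d)), ← Real.exp_add, Real.log_pow]
    refine Real.exp_le_exp.2 ?_
    obtain ⟨hψ, -⟩ := h.integrable_potential_of_entropy_ne_top hfin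
    have h1 := (h.entropy_pi hν hψ).2
    have h2 : α ≤ ∫ x, ψ x ∂(Measure.pi ν) := by
      simpa using integral_mono (integrable_const α) hψ h.lower_const
    have h3 : ∑ i, c i ≤ ∑ i, ent (ν i) + d * (2 * H + 2 * Real.log I) := by
      refine (Finset.sum_le_sum fun i _ => hc' i).trans (le_of_eq ?_)
      rw [Finset.sum_add_distrib]; simp; ring
    push_cast
    linarith
  calc ∫⁻ x, ENNReal.ofReal (euclNorm x ^ 2) ∂(Measure.pi ν)
      = ∫⁻ x : Blocks k, (∏ i, (ν i).rnDeriv volume (x i)) * ENNReal.ofReal (euclNorm x ^ 2) := by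
        rw [pi_eq_withDensity_rnDeriv ν (fun _ => volume) fun i => (hν i).1,
          lintegral_withDensity_eq_lintegral_mul _ hm (by fun_prop)]
        rfl
    _ ≤ ∫⁻ x : Blocks k, ENNReal.ofReal (Real.exp (∑ i, c i - d * α) *
          (euclNorm x ^ 2 * Real.exp (-β * ∑ i, ‖x i‖))) := by
        refine lintegral_mono_ae ?_
        filter_upwards [hae] with x hx
        calc _ ≤ (∏ i, ENNReal.ofReal (Real.exp (c i - α - β * ‖x i‖))) *
              ENNReal.ofReal (euclNorm x ^ 2) := by
              gcongr with i _; exact hx i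
          _ = _ := by
            rw [← ENNReal.ofReal_prod_of_nonneg fun i _ => (Real.exp_pos _).le,
              ← Real.exp_sum, ← ENNReal.ofReal_mul (Real.exp_pos _).le]
            congr 1
            rw [mul_left_comm, ← Real.exp_add, mul_comm]
            congr 2
            rw [Finset.sum_sub_distrib, Finset.sum_sub_distrib, ← Finset.mul_sum]
            simp; ring
    _ = ENNReal.ofReal (Real.exp (∑ i, c i - d * α) *
          ∫ x : Blocks k, euclNorm x ^ 2 * Real.exp (-β * ∑ i, ‖x i‖)) := by
        rw [← integral_const_mul, ofReal_integral_eq_lintegral_ofReal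
          (h.integrable_sq_mul_exp.const_mul _) (Filter.Eventually.of_forall fun x => by
            positivity)]
    _ ≤ _ := by
        refine ENNReal.ofReal_le_ofReal (mul_le_mul_of_nonneg_right hexp ?_)
        exact integral_nonneg fun x => by positivity

/-- The marginals of a minimizer are optimal given the other marginals. -/
theorem eq_gibbs_of_isMinOn (h : IsConfining ψ α β)
    (hmin : IsMinOn (entropy ψ) (productMeasures k) (Measure.pi ν))
    (hfin : entropy ψ (Measure.pi ν) ≠ ∞) (i : Fin d) :
    volume (finiteSet ψ ν i) ≠ 0 ∧ ν i = gibbs ψ ν i := by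
  have hν := h.hasEntropy_of_entropy_pi_ne_top hfin
  have hψ := (h.integrable_potential_of_entropy_ne_top hfin).1
  have hupd : Function.update ν i (ν i) = ν := Function.update_eq_self i ν
  have hψ' : Integrable ψ (Measure.pi (Function.update ν i (ν i))) := by rwa [hupd]
  have hD := h.volume_finiteSet_ne_zero (hν i).1 hψ'
  refine ⟨hD, ?_⟩
  have := h.isProbabilityMeasure_gibbs hD
  have hp := isProbabilityMeasure_update (ν := ν) i (gibbs ψ ν i)
  have hle : entropy ψ (Measure.pi ν) ≤
      entropy ψ (Measure.pi (Function.update ν i (gibbs ψ ν i))) := hmin ⟨_, hp, rfl⟩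
  obtain ⟨h1, h2⟩ := h.entropy_pi hν hψ
  obtain ⟨h3, h4⟩ := h.entropy_pi (ν := Function.update ν i (gibbs ψ ν i))
    (forall_update hν (h.hasEntropy_gibbs hD)) (h.integrable_update_gibbs hD)
  rw [← ENNReal.toReal_le_toReal h1 h3, h2, h4, sum_ent_update] at hle
  obtain ⟨h5, h6⟩ := h.toReal_klDiv_gibbs (hν i) hψ'
  rw [hupd] at h6
  have h7 := h.ent_gibbs_add hD
  -- The gain from replacing block `i` by its Gibbs measure equals this divergence, and minimality
  -- allows no gain.
  have h8 : (InformationTheory.klDiv (ν i) (gibbs ψ ν i)).toReal = 0 :=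
    le_antisymm (by linarith) ENNReal.toReal_nonneg
  rw [ENNReal.toReal_eq_zero_iff] at h8
  exact InformationTheory.klDiv_eq_zero_iff.1 (h8.resolve_right h5)

/-- A minimizer is a fixed point of every block update, so each `-log Z_i` is expressed through the
minimizer's own mean potential. -/
theorem lintegral_sq_minimizer_le (h : IsConfining ψ α β)
    (hmin : IsMinOn (entropy ψ) (productMeasures k) (Measure.pi ν)) {H : ℝ}
    (hfin : entropy ψ (Measure.pi ν) ≠ ∞) (hH : (entropy ψ (Measure.pi ν)).toReal ≤ H) :
    ∫⁻ x, ENNReal.ofReal (euclNorm x ^ 2) ∂(Measure.pi ν) ≤ ENNReal.ofReal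
      (Real.exp ((2 * d + 1) * H - (d + 1) * α)
        * (∫ x : Blocks k, Real.exp (-(β * euclNorm x + α) / 2)) ^ (2 * d)
        * ∫ x : Blocks k, euclNorm x ^ 2 * Real.exp (-β * ∑ i, ‖x i‖)) := by
  have hν := h.hasEntropy_of_entropy_pi_ne_top hfin
  refine h.lintegral_sq_le hν hfin hH (c := fun i => -Real.log (partitionFn ψ ν i))
    (fun i => ?_) fun i => ?_
  · obtain ⟨hD, he⟩ := h.eq_gibbs_of_isMinOn hmin hfin i
    have := h.rnDeriv_gibbs_le hD
    rwa [← he] at this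
  · obtain ⟨hD, he⟩ := h.eq_gibbs_of_isMinOn hmin hfin i
    have h1 := h.ent_gibbs_add hD
    rw [← he, Function.update_eq_self] at h1
    have h2 := (h.integrable_potential_of_entropy_ne_top hfin).2
    linarith

end IsConfining

end CAVI

/-! ### The CAVI sweep: moments, entropies, monotonicity. -/

namespace CAVI

variable {d : ℕ} {k : Fin d → ℕ}

/-- A probability measure with finite `p`-th moment. -/
def HasMoment {E : Type*} [NormedAddCommGroup E] [MeasurableSpace E] (p : ℝ) (τ : Measure E) :
    Prop :=
  IsProbabilityMeasure τ ∧ Integrable (fun x => ‖x‖ ^ p) τ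

theorem euclNorm_rpow_le {p : ℝ} (hp : 0 < p) (x : Blocks k) :
    euclNorm x ^ p ≤ (d : ℝ) ^ p * ∑ i, ‖x i‖ ^ p := by
  rcases isEmpty_or_nonempty (Fin d) with hd | hd
  · have h0 : euclNorm x = 0 := by simp [euclNorm]
    simp [h0, Real.zero_rpow hp.ne']
  · obtain ⟨i, -, hi⟩ := Finset.exists_max_image Finset.univ (fun i => ‖x i‖) Finset.univ_nonempty
    have h1 : ‖x‖ ≤ ‖x i‖ :=
      (pi_norm_le_iff_of_nonneg (norm_nonneg _)).2 fun j => hi j (Finset.mem_univ j)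
    calc euclNorm x ^ p ≤ (d * ‖x i‖) ^ p := by
          refine Real.rpow_le_rpow (euclNorm_nonneg x) ((euclNorm_le_mul_norm x).trans ?_) hp.le
          gcongr
      _ = (d : ℝ) ^ p * ‖x i‖ ^ p := Real.mul_rpow (Nat.cast_nonneg d) (norm_nonneg _)
      _ ≤ _ := by
          gcongr
          exact Finset.single_le_sum (f := fun j => ‖x j‖ ^ p)
            (fun _ _ => Real.rpow_nonneg (norm_nonneg _) _) (Finset.mem_univ i)

/-- The measures during sweep `n`, after the first `j` blocks have been updated. -/
noncomputable def partialSweep (ψ : Blocks k → ℝ)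
    (μ₀ : ∀ i, Measure (EuclideanSpace ℝ (Fin (k i)))) (n j : ℕ) (i : Fin d) :
    Measure (EuclideanSpace ℝ (Fin (k i))) :=
  if i.val < j then iterates ψ μ₀ (n + 1) i else iterates ψ μ₀ n i

section PartialSweep

variable (ψ : Blocks k → ℝ) (μ₀ : ∀ i, Measure (EuclideanSpace ℝ (Fin (k i)))) (n : ℕ)

theorem partialSweep_zero : partialSweep ψ μ₀ n 0 = iterates ψ μ₀ n := by
  funext i; simp [partialSweep]

theorem partialSweep_of_le {j : ℕ} (hj : d ≤ j) :
    partialSweep ψ μ₀ n j = iterates ψ μ₀ (n + 1) := by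
  funext i; rw [partialSweep, if_pos (i.isLt.trans_le hj)]

theorem partialSweep_succ (i : Fin d) : partialSweep ψ μ₀ n (i + 1) =
    Function.update (partialSweep ψ μ₀ n i) i (iterates ψ μ₀ (n + 1) i) := by
  funext j
  rcases eq_or_ne j i with rfl | hj
  · simp [partialSweep]
  · have hne : j.val ≠ i.val := fun e => hj (Fin.ext e)
    rw [Function.update_of_ne hj]
    simp only [partialSweep]
    congr 1
    exact propext (by omega)

theorem iterates_succ_eq_tilted (i : Fin d) : iterates ψ μ₀ (n + 1) i =
    volume.tilted fun x => -potential ψ (partialSweep ψ μ₀ n i) i x := by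
  rw [iterates_succ]; rfl

end PartialSweep

namespace IsConfining

variable {ψ : Blocks k → ℝ} {α β c p : ℝ}
  {ν : ∀ i, Measure (EuclideanSpace ℝ (Fin (k i)))} {i : Fin d}

theorem integrable_comp_update_of_hasMoment (h : IsConfining ψ α β) (hc : 0 ≤ c) (hp : 0 < p)
    (hg : ∀ x, |ψ x| ≤ c * (1 + euclNorm x ^ p)) (hν : ∀ i, HasMoment p (ν i))
    (x : EuclideanSpace ℝ (Fin (k i))) :
    Integrable (fun y => ψ (Function.update y i x)) (Measure.pi ν) := by
  have : ∀ i, IsProbabilityMeasure (ν i) := fun i => (hν i).1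
  have hcont := h.cont
  have hb : Integrable (fun y : Blocks k => c * (1 + (d : ℝ) ^ p *
      (‖x‖ ^ p + ∑ j, ‖y j‖ ^ p))) (Measure.pi ν) := by
    refine ((integrable_const 1).add (((integrable_const (‖x‖ ^ p)).add
      (integrable_finsetSum _ fun j _ => ?_)).const_mul _)).const_mul _
    exact integrable_eval (ν := ν) (f := fun z => ‖z‖ ^ p) j (hν j).2
  refine hb.mono' (by fun_prop) (Filter.Eventually.of_forall fun y => ?_)
  refine (hg _).trans ?_
  gcongr
  refine (euclNorm_rpow_le hp _).trans ?_
  gcongr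
  rw [← Finset.add_sum_erase _ _ (Finset.mem_univ i), Function.update_self]
  gcongr
  rw [Finset.sum_congr rfl fun j hj => by rw [Function.update_of_ne (Finset.ne_of_mem_erase hj)]]
  exact Finset.sum_le_sum_of_subset_of_nonneg (Finset.erase_subset _ _)
    fun j _ _ => Real.rpow_nonneg (norm_nonneg _) _

theorem integrable_of_hasMoment (h : IsConfining ψ α β) (hc : 0 ≤ c) (hp : 0 < p)
    (hg : ∀ x, |ψ x| ≤ c * (1 + euclNorm x ^ p)) (hν : ∀ i, HasMoment p (ν i)) :
    Integrable ψ (Measure.pi ν) := by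
  have : ∀ i, IsProbabilityMeasure (ν i) := fun i => (hν i).1
  have hb : Integrable (fun y : Blocks k => c * (1 + (d : ℝ) ^ p *
      ∑ j, ‖y j‖ ^ p)) (Measure.pi ν) := by
    refine ((integrable_const 1).add ((integrable_finsetSum _ fun j _ => ?_).const_mul _)).const_mul
      _
    exact integrable_eval (ν := ν) (f := fun z => ‖z‖ ^ p) j (hν j).2
  refine hb.mono' h.cont.aestronglyMeasurable (Filter.Eventually.of_forall fun y => ?_)
  refine (hg _).trans ?_
  gcongr
  exact euclNorm_rpow_le hp _

/-- Under moment assumptions the restriction in `gibbs` disappears and it becomes the CAVI update. A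
minimizer has no `p`-th moment assumed, which is why the restricted version is kept in general. -/
theorem finiteSet_eq_univ (h : IsConfining ψ α β) (hc : 0 ≤ c) (hp : 0 < p)
    (hg : ∀ x, |ψ x| ≤ c * (1 + euclNorm x ^ p)) (hν : ∀ i, HasMoment p (ν i)) :
    finiteSet ψ ν i = Set.univ :=
  Set.eq_univ_of_forall fun x => h.integrable_comp_update_of_hasMoment hc hp hg hν x

/-- The exponential tail gives all moments, whatever `ν` is. The growth exponent `p` is used to
continue the recursion, and `2` later for second moments. -/
theorem hasMoment_gibbs (h : IsConfining ψ α β) (hp : 0 < p) [∀ i, IsProbabilityMeasure (ν i)]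
    (hD : volume (finiteSet ψ ν i) ≠ 0) : HasMoment p (gibbs ψ ν i) := by
  refine ⟨h.isProbabilityMeasure_gibbs hD, ?_⟩
  have hm := h.measurable_potential (ν := ν) (i := i)
  refine (integrable_tilted_iff h.integrable_exp_potential _).2 ?_
  have hI : Integrable fun x : EuclideanSpace ℝ (Fin (k i)) =>
      Real.exp (-α) * (‖x‖ ^ p * Real.exp (-(β * ‖x‖))) := by
    refine integrable_of_norm_le_rpow_mul_exp volume (by fun_prop) (Real.exp_pos (-α)).le hp.le
      h.pos fun x => ?_
    rw [Real.norm_eq_abs, abs_of_nonneg (by positivity)]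
  refine (hI.integrableOn (s := finiteSet ψ ν i)).mono' (by fun_prop) ?_
  filter_upwards [ae_restrict_mem h.measurableSet_finiteSet] with x hx
  rw [norm_smul, Real.norm_eq_abs, Real.norm_eq_abs, abs_of_pos (Real.exp_pos _),
    abs_of_nonneg (by positivity)]
  calc _ ≤ Real.exp (-α) * Real.exp (-(β * ‖x‖)) * ‖x‖ ^ p := by
        gcongr; exact h.exp_neg_potential_le hx
    _ = _ := by ring

variable {μ₀ : ∀ i, Measure (EuclideanSpace ℝ (Fin (k i)))} {n : ℕ}

theorem volume_finiteSet_ne_zero_of_hasMoment (h : IsConfining ψ α β) (hc : 0 ≤ c) (hp : 0 < p)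
    (hg : ∀ x, |ψ x| ≤ c * (1 + euclNorm x ^ p)) (hν : ∀ i, HasMoment p (ν i)) :
    volume (finiteSet ψ ν i) ≠ 0 := by
  rw [h.finiteSet_eq_univ hc hp hg hν]; exact NeZero.ne _

theorem iterates_succ_eq_gibbs (h : IsConfining ψ α β) (hc : 0 ≤ c) (hp : 0 < p)
    (hg : ∀ x, |ψ x| ≤ c * (1 + euclNorm x ^ p))
    (hν : ∀ j, HasMoment p (partialSweep ψ μ₀ n i j)) :
    iterates ψ μ₀ (n + 1) i = gibbs ψ (partialSweep ψ μ₀ n i) i := by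
  rw [iterates_succ_eq_tilted, gibbs, h.finiteSet_eq_univ hc hp hg hν, Measure.restrict_univ]

theorem hasMoment_partialSweep (h : IsConfining ψ α β) (hc : 0 ≤ c) (hp : 0 < p)
    (hg : ∀ x, |ψ x| ≤ c * (1 + euclNorm x ^ p))
    (hν : ∀ j, HasMoment p (iterates ψ μ₀ n j)) (j : ℕ) :
    ∀ i, HasMoment p (partialSweep ψ μ₀ n j i) := by
  induction j with
  | zero => rwa [partialSweep_zero]
  | succ j ih =>
    rcases lt_or_ge j d with hj | hj
    · have : ∀ i, IsProbabilityMeasure (partialSweep ψ μ₀ n j i) := fun i => (ih i).1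
      have e := partialSweep_succ ψ μ₀ n ⟨j, hj⟩
      simp only at e
      rw [e, h.iterates_succ_eq_gibbs (i := ⟨j, hj⟩) hc hp hg ih]
      exact forall_update (P := fun _ τ => HasMoment p τ) ih
        (h.hasMoment_gibbs hp (h.volume_finiteSet_ne_zero_of_hasMoment hc hp hg ih))
    · rw [partialSweep_of_le ψ μ₀ n (hj.trans j.le_succ), ← partialSweep_of_le ψ μ₀ n hj]
      exact ih

theorem hasMoment_iterates (h : IsConfining ψ α β) (hc : 0 ≤ c) (hp : 0 < p)
    (hg : ∀ x, |ψ x| ≤ c * (1 + euclNorm x ^ p)) (hμ₀ : ∀ i, HasMoment p (μ₀ i)) :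
    ∀ n i, HasMoment p (iterates ψ μ₀ n i) := by
  intro n
  induction n with
  | zero => exact hμ₀
  | succ n ih =>
    rw [← partialSweep_of_le ψ μ₀ n le_rfl]
    exact h.hasMoment_partialSweep hc hp hg ih d

theorem hasEntropy_iterates (h : IsConfining ψ α β) (hc : 0 ≤ c) (hp : 0 < p)
    (hg : ∀ x, |ψ x| ≤ c * (1 + euclNorm x ^ p)) (hμ₀ : ∀ i, HasMoment p (μ₀ i)) (n : ℕ)
    (i : Fin d) : HasEntropy (iterates ψ μ₀ (n + 1) i) := by
  have hm := h.hasMoment_partialSweep hc hp hg (h.hasMoment_iterates hc hp hg hμ₀ n) i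
  have : ∀ j, IsProbabilityMeasure (partialSweep ψ μ₀ n i j) := fun j => (hm j).1
  rw [h.iterates_succ_eq_gibbs hc hp hg hm]
  exact h.hasEntropy_gibbs (h.volume_finiteSet_ne_zero_of_hasMoment hc hp hg hm)

theorem entropy_iterate_ne_top (h : IsConfining ψ α β) (hc : 0 ≤ c) (hp : 0 < p)
    (hg : ∀ x, |ψ x| ≤ c * (1 + euclNorm x ^ p)) (hμ₀ : ∀ i, HasMoment p (μ₀ i)) (n : ℕ) :
    entropy ψ (iterate ψ μ₀ (n + 1)) ≠ ∞ := by
  have hm := h.hasMoment_iterates hc hp hg hμ₀ (n + 1)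
  have : ∀ j, IsProbabilityMeasure (iterates ψ μ₀ (n + 1) j) := fun j => (hm j).1
  exact (h.entropy_pi (h.hasEntropy_iterates hc hp hg hμ₀ n)
    (h.integrable_of_hasMoment hc hp hg hm)).1

/-- The index starts at `n + 1`: in the very first sweep some blocks are still those of `μ₀`, which
may be singular. -/
theorem hasEntropy_partialSweep (h : IsConfining ψ α β) (hc : 0 ≤ c) (hp : 0 < p)
    (hg : ∀ x, |ψ x| ≤ c * (1 + euclNorm x ^ p)) (hμ₀ : ∀ i, HasMoment p (μ₀ i)) (n j : ℕ)
    (i : Fin d) : HasEntropy (partialSweep ψ μ₀ (n + 1) j i) := by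
  rw [partialSweep]
  split_ifs
  · exact h.hasEntropy_iterates hc hp hg hμ₀ (n + 1) i
  · exact h.hasEntropy_iterates hc hp hg hμ₀ n i

/-- Descent is tracked block by block because the moment bound needs the entropy of the intermediate
measures too. -/
theorem entropy_partialSweep_le (h : IsConfining ψ α β) (hc : 0 ≤ c) (hp : 0 < p)
    (hg : ∀ x, |ψ x| ≤ c * (1 + euclNorm x ^ p)) (hμ₀ : ∀ i, HasMoment p (μ₀ i)) (n j : ℕ) :
    entropy ψ (Measure.pi (partialSweep ψ μ₀ (n + 1) j)) ≤
      entropy ψ (iterate ψ μ₀ (n + 1)) := by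
  induction j with
  | zero => rw [partialSweep_zero, iterate]
  | succ j ih =>
    rcases lt_or_ge j d with hj | hj
    · refine le_trans ?_ ih
      have hm := h.hasMoment_partialSweep hc hp hg (h.hasMoment_iterates hc hp hg hμ₀ (n + 1)) j
      have : ∀ i, IsProbabilityMeasure (partialSweep ψ μ₀ (n + 1) j i) := fun i => (hm i).1
      have e := partialSweep_succ ψ μ₀ (n + 1) ⟨j, hj⟩
      simp only at e
      rw [e, h.iterates_succ_eq_gibbs (i := ⟨j, hj⟩) hc hp hg hm]
      exact h.entropy_update_gibbs_le (h.hasEntropy_partialSweep hc hp hg hμ₀ n j)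
        (h.integrable_of_hasMoment hc hp hg hm) _
    · rw [partialSweep_of_le ψ μ₀ _ (hj.trans j.le_succ), ← partialSweep_of_le ψ μ₀ _ hj]
      exact ih

/-- The entropy does not increase along the iterates. -/
theorem entropy_iterate_le (h : IsConfining ψ α β) (hc : 0 ≤ c) (hp : 0 < p)
    (hg : ∀ x, |ψ x| ≤ c * (1 + euclNorm x ^ p)) (hμ₀ : ∀ i, HasMoment p (μ₀ i)) (n : ℕ) :
    entropy ψ (iterate ψ μ₀ (n + 1)) ≤ entropy ψ (iterate ψ μ₀ 1) := by
  induction n with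
  | zero => rfl
  | succ n ih =>
    refine le_trans ?_ ih
    have := h.entropy_partialSweep_le hc hp hg hμ₀ n d
    rwa [partialSweep_of_le ψ μ₀ _ le_rfl] at this

/-- Block `i` is Gibbs relative to the state before its update, and its `-log Z` involves the mean
of `ψ` just after it; hence the hypothesis on the state with index `i + 1`. -/
theorem lintegral_sq_iterate_le (h : IsConfining ψ α β) (hc : 0 ≤ c) (hp : 0 < p)
    (hg : ∀ x, |ψ x| ≤ c * (1 + euclNorm x ^ p)) (hμ₀ : ∀ i, HasMoment p (μ₀ i)) (n : ℕ)
    {H : ℝ} (hH : ∀ i : Fin d, entropy ψ (Measure.pi (partialSweep ψ μ₀ n (i + 1))) ≠ ∞ ∧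
      (entropy ψ (Measure.pi (partialSweep ψ μ₀ n (i + 1)))).toReal ≤ H)
    (hH' : (entropy ψ (iterate ψ μ₀ (n + 1))).toReal ≤ H) :
    ∫⁻ x, ENNReal.ofReal (euclNorm x ^ 2) ∂(iterate ψ μ₀ (n + 1)) ≤ ENNReal.ofReal
      (Real.exp ((2 * d + 1) * H - (d + 1) * α)
        * (∫ x : Blocks k, Real.exp (-(β * euclNorm x + α) / 2)) ^ (2 * d)
        * ∫ x : Blocks k, euclNorm x ^ 2 * Real.exp (-β * ∑ i, ‖x i‖)) := by
  have hmom := h.hasMoment_iterates hc hp hg hμ₀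
  have : ∀ i, IsProbabilityMeasure (iterates ψ μ₀ (n + 1) i) := fun i => (hmom (n + 1) i).1
  have hm := fun j => h.hasMoment_partialSweep hc hp hg (hmom n) j
  have hpr : ∀ j i, IsProbabilityMeasure (partialSweep ψ μ₀ n j i) := fun j i => (hm j i).1
  have hD : ∀ i : Fin d, volume (finiteSet ψ (partialSweep ψ μ₀ n i) i) ≠ 0 := fun i =>
    h.volume_finiteSet_ne_zero_of_hasMoment hc hp hg (hm i)
  have he : ∀ i : Fin d, iterates ψ μ₀ (n + 1) i = gibbs ψ (partialSweep ψ μ₀ n i) i := fun i =>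
    h.iterates_succ_eq_gibbs hc hp hg (hm i)
  refine h.lintegral_sq_le (h.hasEntropy_iterates hc hp hg hμ₀ n)
    (h.entropy_iterate_ne_top hc hp hg hμ₀ n) hH'
    (c := fun i => -Real.log (partitionFn ψ (partialSweep ψ μ₀ n i) i)) (fun i => ?_) fun i => ?_
  · rw [he i]; exact h.rnDeriv_gibbs_le (hD i)
  · have h1 := h.ent_gibbs_add (hD i)
    rw [← he i, ← partialSweep_succ] at h1
    have h2 := (h.integrable_potential_of_entropy_ne_top (hH i).1).2
    linarith [(hH i).2]

end IsConfining

end CAVI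

/-! ### Radial integrals and the numerical inequality for the first iterate. -/

namespace CAVI

variable {d : ℕ} {k : Fin d → ℕ}

/-- Integration of radial functions in polar coordinates. -/
theorem exists_integral_pow_mul_exp (hk : 0 < ∑ i, k i) :
    ∃ C : ℝ, 0 < C ∧ ∀ (q : ℕ) (t : ℝ), 0 < t →
      ∫ x : Blocks k, euclNorm x ^ q * Real.exp (-(t * euclNorm x)) =
        C * ((∑ i, k i + q - 1).factorial / t ^ (∑ i, k i + q)) := by
  set K := ∑ i, k i
  -- On `PiLp 2` the Euclidean norm is the actual norm, so polar coordinates for a Haar measure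
  -- apply.
  let L := (PiLp.continuousLinearEquiv 2 ℝ fun i => EuclideanSpace ℝ (Fin (k i))).symm
  set μ := (volume : Measure (Blocks k)).map L
  have hμ : μ.IsAddHaarMeasure := L.isAddHaarMeasure_map volume
  have hfr : Module.finrank ℝ (PiLp 2 fun i => EuclideanSpace ℝ (Fin (k i))) = K := by
    rw [← L.toLinearEquiv.finrank_eq, Module.finrank_pi_fintype]; simp [K]
  have hnt : Nontrivial (PiLp 2 fun i => EuclideanSpace ℝ (Fin (k i))) :=
    Module.nontrivial_of_finrank_pos (R := ℝ) (hfr.symm ▸ hk)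
  have hball : 0 < μ.real (Metric.ball 0 1) :=
    ENNReal.toReal_pos (Metric.measure_ball_pos μ 0 one_pos).ne' measure_ball_lt_top.ne
  refine ⟨K * μ.real (Metric.ball 0 1), by positivity, fun q t ht => ?_⟩
  have h1 : ∫ x : Blocks k, euclNorm x ^ q * Real.exp (-(t * euclNorm x)) =
      ∫ z, ‖z‖ ^ q * Real.exp (-(t * ‖z‖)) ∂μ := by
    rw [integral_map L.continuous.measurable.aemeasurable (by fun_prop)]
    refine integral_congr_ae (Filter.Eventually.of_forall fun x => ?_)
    simp only [euclNorm_eq_norm]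
    rfl
  rw [h1, integral_fun_norm_addHaar μ fun r => r ^ q * Real.exp (-(t * r)), hfr, nsmul_eq_mul,
    smul_eq_mul, ← mul_assoc]
  congr 1
  have h2 := Real.integral_rpow_mul_exp_neg_mul_Ioi (a := (K + q : ℕ)) (r := t)
    (by exact_mod_cast (by omega : 0 < K + q)) ht
  have h3 : Real.Gamma ((K + q : ℕ) : ℝ) = (K + q - 1).factorial := by
    rw [← Real.Gamma_nat_eq_factorial]
    congr 1
    rw [Nat.cast_sub (by omega)]; push_cast; ring
  rw [h3, Real.rpow_natCast, one_div, inv_pow, inv_mul_eq_div] at h2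
  rw [← h2]
  refine setIntegral_congr_fun measurableSet_Ioi fun y hy => ?_
  have h4 : ((K + q : ℕ) : ℝ) - 1 = ((K - 1 + q : ℕ) : ℝ) := by
    rw [show K + q = K - 1 + q + 1 by omega]; push_cast; ring
  simp only [smul_eq_mul]
  rw [h4, Real.rpow_natCast, pow_add]
  ring

theorem log_four_thirds_le : Real.log (4 / 3) ≤ 0.29 := by
  rw [Real.log_le_iff_le_exp (by norm_num)]
  -- Half of `0.29`: the square of the quadratic Taylor bound there already exceeds `4 / 3`.
  have h1 := Real.quadratic_le_exp_of_nonneg (x := 0.145) (by norm_num)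
  have h2 : Real.exp 0.29 = Real.exp 0.145 ^ 2 := by
    rw [← Real.exp_nat_mul]; norm_num
  rw [h2]
  nlinarith

/-- Bernoulli's inequality for the exponent `K - 2`. The constant is `16 * (9/32) * 16 * 0.29²`, as
it arises in `moment_bound_numeric`. -/
theorem mul_le_mul_nine_fourths_pow {K : ℕ} (hK : 2 ≤ K) :
    (6.0552 : ℝ) * K ≤ (K + 1) * (9 / 4) ^ K := by
  obtain ⟨n, rfl⟩ := Nat.exists_eq_add_of_le hK
  have h1 := one_add_mul_le_pow (a := (5 / 4 : ℝ)) (by norm_num) n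
  have h2 : (9 / 4 : ℝ) ^ (2 + n) = 81 / 16 * (1 + 5 / 4) ^ n := by
    rw [pow_add]; norm_num
  have hn : (0 : ℝ) ≤ n := n.cast_nonneg
  rw [h2]
  push_cast
  nlinarith [mul_nonneg hn hn]

theorem eight_mul_le_four_pow {d : ℕ} (hd : 2 ≤ d) : 8 * d ≤ 4 ^ d := by
  induction d, hd using Nat.le_induction with
  | base => norm_num
  | succ n hn ih => rw [pow_succ]; omega

/-- The elementary inequality behind the moment bound for the first iterate. -/
theorem moment_bound_numeric {d K : ℕ} (hd : 2 ≤ d) (hK : d ≤ K) {H α β S I T M u : ℝ}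
    (hβ : 0 < β) (hS : 0 < S) (hu : u = H - α + Real.log S) (hu0 : 0 ≤ u) (hM0 : 0 ≤ M)
    (hM : M ≤ 4 / β * (u + K * Real.log (4 / 3))) (hI : I = Real.exp (-α / 2) * (2 ^ K * S))
    (hT : K * (K + 1) / (β ^ 2 * d ^ K) * S ≤ T) :
    16 * (32 / 9) ^ (K - 1) * M ^ 2 ≤
      Real.exp ((2 * d + 1) * H - (d + 1) * α) * I ^ (2 * d) * T := by
  have hd0 : (0 : ℝ) < d := by exact_mod_cast (by omega : 0 < d)
  have hK2 : (2 : ℝ) ≤ K := by exact_mod_cast hd.trans hK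
  have hdR : (2 : ℝ) ≤ d := by exact_mod_cast hd
  -- After inserting `I` and the lower bound for `T`, the quantities `H`, `α` and `S` enter only
  -- through `u`.
  have e1 : Real.exp ((2 * d + 1) * H - (d + 1) * α) * I ^ (2 * d) *
      (K * (K + 1) / (β ^ 2 * d ^ K) * S) =
      Real.exp ((2 * d + 1) * u) * (4 ^ d / d) ^ K * (K * (K + 1)) / β ^ 2 := by
    have hS1 : Real.exp ((2 * d + 1) * u) =
        Real.exp ((2 * d + 1) * H - (2 * d + 1) * α) * S ^ (2 * d + 1) := by
      rw [← Real.exp_log (pow_pos hS (2 * d + 1)), Real.log_pow, ← Real.exp_add, hu]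
      congr 1; push_cast; ring
    have hS2 : Real.exp (-α / 2) ^ (2 * d) = Real.exp (-(d * α)) := by
      rw [← Real.exp_nat_mul]; congr 1; push_cast; ring
    have hS3 : Real.exp ((2 * d + 1) * H - (2 * d + 1) * α) =
        Real.exp ((2 * d + 1) * H - (d + 1) * α) * Real.exp (-(d * α)) := by
      rw [← Real.exp_add]; congr 1; ring
    have hp : ((2 : ℝ) ^ K) ^ (2 * d) = (4 ^ d) ^ K := by
      rw [← pow_mul, ← pow_mul, show (4 : ℝ) = 2 ^ 2 by norm_num, ← pow_mul]; congr 1; ring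
    rw [hI, mul_pow, mul_pow, hS1, hS2, hS3, hp, div_pow]
    field_simp
    ring
  -- Reduction to the worst case `d = 2`, using `u ≥ 0`.
  have e2 : Real.exp (5 * u) * 8 ^ K * (K * (K + 1)) / β ^ 2 ≤
      Real.exp ((2 * d + 1) * u) * (4 ^ d / d) ^ K * (K * (K + 1)) / β ^ 2 := by
    have h8 : (8 : ℝ) ≤ 4 ^ d / d := by
      rw [le_div_iff₀ hd0]; exact_mod_cast eight_mul_le_four_pow hd
    have h5 : 5 * u ≤ (2 * d + 1) * u := by nlinarith
    gcongr
  have e3 : 16 * (32 / 9) ^ (K - 1) * M ^ 2 ≤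
      Real.exp (5 * u) * 8 ^ K * (K * (K + 1)) / β ^ 2 := by
    have hM' : M ≤ 4 / β * (u + K * 0.29) := hM.trans (by
      have := log_four_thirds_le
      gcongr)
    have hexp : (1 + 5 / 2 * u) ^ 2 ≤ Real.exp (5 * u) := by
      have h1 := Real.add_one_le_exp (5 / 2 * u)
      have h2 : Real.exp (5 * u) = Real.exp (5 / 2 * u) ^ 2 := by
        rw [← Real.exp_nat_mul]; congr 1; push_cast; ring
      rw [h2]; gcongr; linarith
    -- Needs `0.29 * (5 / 2) * K ≥ 1`, which holds from `K = 2` on.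
    have hlin : u + K * 0.29 ≤ K * 0.29 * (1 + 5 / 2 * u) := by nlinarith
    have hK1 : (32 / 9 : ℝ) ^ (K - 1) = 9 / 32 * (32 / 9) ^ K := by
      rw [show K = K - 1 + 1 by omega, pow_succ]
      simp only [Nat.add_sub_cancel]; ring
    have h8 : (8 : ℝ) ^ K = (32 / 9) ^ K * (9 / 4) ^ K := by
      rw [← mul_pow]; norm_num
    calc 16 * (32 / 9) ^ (K - 1) * M ^ 2
        ≤ 16 * (9 / 32 * (32 / 9) ^ K) * (4 / β * (K * 0.29 * (1 + 5 / 2 * u))) ^ 2 := by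
          rw [hK1]
          have := hM'.trans (mul_le_mul_of_nonneg_left hlin (by positivity))
          gcongr
      _ = (6.0552 * K) * K * (32 / 9) ^ K * (1 + 5 / 2 * u) ^ 2 / β ^ 2 := by
          field_simp; ring
      _ ≤ ((K + 1) * (9 / 4) ^ K) * K * (32 / 9) ^ K * Real.exp (5 * u) / β ^ 2 := by
          have := mul_le_mul_nine_fourths_pow (hd.trans hK)
          gcongr
      _ = _ := by rw [h8]; ring
  have hI0 : 0 ≤ I := by rw [hI]; positivity
  calc _ ≤ _ := e3.trans e2
    _ = _ := e1.symm
    _ ≤ _ := by gcongr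

end CAVI

/-! ### Second moment of the first iterate by log-concavity. -/

namespace CAVI

variable {d : ℕ} {k : Fin d → ℕ}

namespace IsConfining

variable {ψ : Blocks k → ℝ} {α β c p : ℝ}
  {ν : ∀ i, Measure (EuclideanSpace ℝ (Fin (k i)))} {i : Fin d}

theorem convexOn_potential (h : IsConfining ψ α β) (hconv : ConvexOn ℝ Set.univ ψ) (hc : 0 ≤ c)
    (hp : 0 < p) (hg : ∀ x, |ψ x| ≤ c * (1 + euclNorm x ^ p)) (hν : ∀ i, HasMoment p (ν i)) :
    ConvexOn ℝ Set.univ (potential ψ ν i) := by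
  have hint := fun x => h.integrable_comp_update_of_hasMoment (i := i) hc hp hg hν x
  refine ⟨convex_univ, fun x _ y _ a b ha hb hab => ?_⟩
  simp only [potential, smul_eq_mul]
  rw [← integral_const_mul, ← integral_const_mul,
    ← integral_add ((hint x).const_mul a) ((hint y).const_mul b)]
  refine integral_mono (hint _) (((hint x).const_mul a).add ((hint y).const_mul b)) fun z => ?_
  have e : Function.update z i (a • x + b • y) =
      a • Function.update z i x + b • Function.update z i y := by
    funext j
    rcases eq_or_ne j i with rfl | hj
    · simp
    · simp [Function.update_of_ne hj, ← add_smul, hab]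
  simp only [e]
  exact hconv.2 (Set.mem_univ _) (Set.mem_univ _) ha hb hab

/-- Averaging over the other blocks preserves convexity, so the Gibbs measure is log-concave; adding
`log Z` to the potential normalizes it. -/
theorem integral_norm_sq_gibbs_le (h : IsConfining ψ α β) (hconv : ConvexOn ℝ Set.univ ψ)
    (hc : 0 ≤ c) (hp : 0 < p) (hg : ∀ x, |ψ x| ≤ c * (1 + euclNorm x ^ p))
    (hν : ∀ i, HasMoment p (ν i)) :
    ∫ x, ‖x‖ ^ 2 ∂(gibbs ψ ν i) ≤ 16 * (32 / 9) ^ k i * (∫ x, ‖x‖ ∂(gibbs ψ ν i)) ^ 2 := by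
  have : ∀ i, IsProbabilityMeasure (ν i) := fun i => (hν i).1
  have hU := h.finiteSet_eq_univ (i := i) hc hp hg hν
  have hZ : ∫ x, Real.exp (-potential ψ ν i x) = partitionFn ψ ν i := by
    rw [partitionFn, hU, Measure.restrict_univ]
  have hZ0 := h.partitionFn_pos (h.volume_finiteSet_ne_zero_of_hasMoment (i := i) hc hp hg hν)
  set V := fun x => potential ψ ν i x + Real.log (partitionFn ψ ν i)
  have hV : ∀ x, Real.exp (-V x) = Real.exp (-potential ψ ν i x) / partitionFn ψ ν i := fun x => by
    simp only [V]
    rw [neg_add, ← sub_eq_add_neg, Real.exp_sub, Real.exp_log hZ0]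
  have hint : ∀ f : EuclideanSpace ℝ (Fin (k i)) → ℝ, ∫ x, f x ∂(gibbs ψ ν i) =
      ∫ x, f x * Real.exp (-V x) := fun f => by
    rw [gibbs, hU, Measure.restrict_univ, integral_tilted, hZ]
    simp_rw [hV, smul_eq_mul, mul_comm]
  rw [hint, hint]
  have hVc : ConvexOn ℝ Set.univ V := (h.convexOn_potential hconv hc hp hg hν).add_const _
  have := integral_norm_sq_le_of_logConcave volume hVc
    (a := α + Real.log (partitionFn ψ ν i)) h.pos (fun x => by
      have := h.lower_potential (hU.symm ▸ Set.mem_univ x : x ∈ finiteSet ψ ν i)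
      simp only [V]; linarith) (by
      simp_rw [hV]; rw [integral_div, hZ, div_self hZ0.ne'])
  simpa using this

/-- Finite relative entropy controls the first moment. -/
theorem integral_euclNorm_le (h : IsConfining ψ α β) {m : Measure (Blocks k)}
    [IsProbabilityMeasure m] (hm : entropy ψ m ≠ ∞) :
    Integrable euclNorm m ∧ ∫ x, euclNorm x ∂m ≤ 4 / β * ((entropy ψ m).toReal - α
      + Real.log (∫ x : Blocks k, Real.exp (-(3 / 4 * β * euclNorm x)))) := by
  have hcont := h.cont
  have hβ := h.pos
  have := h.isProbabilityMeasure_target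
  have hJ : Integrable fun x : Blocks k => Real.exp (-(3 / 4 * β * euclNorm x)) := by
    refine integrable_of_norm_le_euclNorm (by fun_prop) zero_le_one le_rfl
      (by positivity : 0 < 3 / 4 * β) fun x => ?_
    simp
  have hbd : ∀ x, Real.exp (-ψ x) * Real.exp (β / 4 * euclNorm x) ≤
      Real.exp (-α) * Real.exp (-(3 / 4 * β * euclNorm x)) := fun x => by
    rw [← Real.exp_add, ← Real.exp_add]
    exact Real.exp_le_exp.2 (by linarith [h.lower x])
  have hI : Integrable fun x => Real.exp (-ψ x) * Real.exp (β / 4 * euclNorm x) :=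
    (hJ.const_mul _).mono' (by fun_prop) (Filter.Eventually.of_forall fun x => by
      rw [Real.norm_eq_abs, abs_of_pos (by positivity)]; exact hbd x)
  -- The weight `β / 4` leaves three quarters of the decay; scaling the remaining integral later
  -- produces the term `K * log (4 / 3)`.
  obtain ⟨h1, h2⟩ := integrable_and_integral_le_klDiv_add_log (μ := m) (ρ := target ψ)
    (φ := fun x => β / 4 * euclNorm x) (by fun_prop) (C := 0)
    (fun x => mul_nonneg (by positivity) (euclNorm_nonneg x))
    ((h.integrable_target_iff _).2 hI) hm
  have h3 : Integrable euclNorm m := by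
    refine (h1.const_mul (4 / β)).congr (Filter.Eventually.of_forall fun x => ?_)
    simp only; field_simp
  refine ⟨h3, ?_⟩
  have h4 : Real.log (∫ x, Real.exp (β / 4 * euclNorm x) ∂(target ψ)) ≤
      -α + Real.log (∫ x : Blocks k, Real.exp (-(3 / 4 * β * euclNorm x))) := by
    rw [h.integral_target]
    have hlog := Real.log_mul (Real.exp_pos (-α)).ne' (integral_exp_pos hJ).ne'
    rw [Real.log_exp] at hlog
    rw [← hlog, ← integral_const_mul]
    refine Real.log_le_log ?_ (integral_mono hI (hJ.const_mul _) hbd)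
    have e : ∀ x, Real.exp (-ψ x) * Real.exp (β / 4 * euclNorm x) =
      Real.exp (-ψ x + β / 4 * euclNorm x) := fun x => (Real.exp_add _ _).symm
    simp_rw [e] at hI ⊢
    exact integral_exp_pos hI
  rw [integral_const_mul] at h2
  have h5 : (entropy ψ m).toReal = (InformationTheory.klDiv m (target ψ)).toReal := rfl
  rw [div_mul_eq_mul_div, le_div_iff₀ hβ]
  linarith

end IsConfining

/-- The sum of the squared mean norms of the blocks is at most the squared mean norm. -/
theorem sum_sq_integral_norm_le {m : Measure (Blocks k)}
    (hm : Integrable euclNorm m) : ∑ i, (∫ x, ‖x i‖ ∂m) ^ 2 ≤ (∫ x, euclNorm x ∂m) ^ 2 := by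
  set a : Fin d → ℝ := fun i => ∫ x, ‖x i‖ ∂m
  have hi : ∀ i, Integrable (fun x : Blocks k => ‖x i‖) m := fun i =>
    hm.mono' (measurable_pi_apply i).norm.aestronglyMeasurable
      (Filter.Eventually.of_forall fun x => by simpa using norm_apply_le_euclNorm x i)
  -- Cauchy–Schwarz against the vector of means; integrating it and cancelling one factor proves the
  -- claim.
  have h1 : ∀ x : Blocks k, ∑ i, a i * ‖x i‖ ≤ √(∑ i, a i ^ 2) * euclNorm x := fun x => by
    rw [euclNorm]; exact Real.sum_mul_le_sqrt_mul_sqrt _ _ _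
  have h2 : ∑ i, a i ^ 2 ≤ √(∑ i, a i ^ 2) * ∫ x, euclNorm x ∂m := by
    calc ∑ i, a i ^ 2 = ∫ x, ∑ i, a i * ‖x i‖ ∂m := by
          rw [integral_finsetSum _ fun i _ => (hi i).const_mul _]
          refine Finset.sum_congr rfl fun i _ => ?_
          rw [integral_const_mul, sq]
      _ ≤ ∫ x, √(∑ i, a i ^ 2) * euclNorm x ∂m :=
          integral_mono (integrable_finsetSum _ fun i _ => (hi i).const_mul _) (hm.const_mul _) h1
      _ = _ := integral_const_mul _ _
  have h3 : 0 ≤ ∑ i, a i ^ 2 := Finset.sum_nonneg fun _ _ => sq_nonneg _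
  have h4 := Real.sq_sqrt h3
  have h5 := Real.sqrt_nonneg (∑ i, a i ^ 2)
  have h6 : 0 ≤ ∫ x, euclNorm x ∂m := integral_nonneg euclNorm_nonneg
  rcases h5.eq_or_lt with h7 | h7
  · rw [← h4, ← h7]; simpa using sq_nonneg _
  · have : √(∑ i, a i ^ 2) ≤ ∫ x, euclNorm x ∂m := by
      refine le_of_mul_le_mul_left ?_ h7
      nlinarith
    calc ∑ i, a i ^ 2 = √(∑ i, a i ^ 2) ^ 2 := h4.symm
      _ ≤ _ := by gcongr

namespace IsConfining

variable {ψ : Blocks k → ℝ} {α β c p : ℝ}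
  {μ₀ : ∀ i, Measure (EuclideanSpace ℝ (Fin (k i)))}

/-- The second moment of an iterate, in terms of its first moment. -/
theorem lintegral_sq_iterate_le_first_moment (h : IsConfining ψ α β) (hk : ∀ i, 0 < k i)
    (hd : 2 ≤ d) (hconv : ConvexOn ℝ Set.univ ψ) (hc : 0 ≤ c) (hp : 0 < p)
    (hg : ∀ x, |ψ x| ≤ c * (1 + euclNorm x ^ p)) (hμ₀ : ∀ i, HasMoment p (μ₀ i)) (n : ℕ)
    (hI : Integrable euclNorm (iterate ψ μ₀ (n + 1))) :
    ∫⁻ x, ENNReal.ofReal (euclNorm x ^ 2) ∂(iterate ψ μ₀ (n + 1)) ≤ ENNReal.ofReal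
      (16 * (32 / 9) ^ (∑ i, k i - 1) * (∫ x, euclNorm x ∂(iterate ψ μ₀ (n + 1))) ^ 2) := by
  have hmom := h.hasMoment_iterates hc hp hg hμ₀
  have : ∀ i, IsProbabilityMeasure (iterates ψ μ₀ (n + 1) i) := fun i => (hmom (n + 1) i).1
  have hm := fun j => h.hasMoment_partialSweep hc hp hg (hmom n) j
  have hpr : ∀ j i, IsProbabilityMeasure (partialSweep ψ μ₀ n j i) := fun j i => (hm j i).1
  have he : ∀ i : Fin d, iterates ψ μ₀ (n + 1) i = gibbs ψ (partialSweep ψ μ₀ n i) i := fun i =>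
    h.iterates_succ_eq_gibbs hc hp hg (hm i)
  have h2 : ∀ i : Fin d, Integrable (fun x => ‖x‖ ^ 2) (iterates ψ μ₀ (n + 1) i) := fun i => by
    rw [he i]
    simpa using (h.hasMoment_gibbs (p := 2) two_pos
      (h.volume_finiteSet_ne_zero_of_hasMoment hc hp hg (hm i))).2
  have h2' : ∀ i ∈ Finset.univ, Integrable (fun x : Blocks k => ‖x i‖ ^ 2)
      (iterate ψ μ₀ (n + 1)) := fun i _ =>
    integrable_eval (ν := iterates ψ μ₀ (n + 1)) (f := fun z => ‖z‖ ^ 2) i (h2 i)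
  have hsq : Integrable (fun x : Blocks k => euclNorm x ^ 2) (iterate ψ μ₀ (n + 1)) := by
    simp_rw [euclNorm_sq]; exact integrable_finsetSum _ h2'
  rw [← ofReal_integral_eq_lintegral_ofReal hsq
    (Filter.Eventually.of_forall fun x => sq_nonneg _)]
  refine ENNReal.ofReal_le_ofReal ?_
  -- A second block has dimension at least one, which saves a factor `32 / 9` needed in the
  -- numerical inequality.
  have hki : ∀ i, k i ≤ ∑ i, k i - 1 := fun i => by
    obtain ⟨j, hj⟩ : ∃ j : Fin d, j ≠ i := by
      have : Nontrivial (Fin d) := Fin.nontrivial_iff_two_le.2 hd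
      exact exists_ne i
    have h1 := Finset.add_le_sum (f := k) (s := Finset.univ) (fun _ _ => Nat.zero_le _)
      (Finset.mem_univ j) (Finset.mem_univ i) hj
    have := hk j
    omega
  calc ∫ x, euclNorm x ^ 2 ∂(iterate ψ μ₀ (n + 1))
      = ∑ i, ∫ x, ‖x‖ ^ 2 ∂(iterates ψ μ₀ (n + 1) i) := by
        simp_rw [euclNorm_sq]
        rw [integral_finsetSum _ h2']
        exact Finset.sum_congr rfl fun i _ => integral_eval (ν := iterates ψ μ₀ (n + 1))
          (f := fun z => ‖z‖ ^ 2) i (h2 i).1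
    _ ≤ ∑ i, 16 * (32 / 9) ^ (∑ i, k i - 1) * (∫ x, ‖x‖ ∂(iterates ψ μ₀ (n + 1) i)) ^ 2 := by
        refine Finset.sum_le_sum fun i _ => ?_
        have h3 := h.integral_norm_sq_gibbs_le (i := i) hconv hc hp hg (hm i)
        rw [← he i] at h3
        refine h3.trans ?_
        gcongr
        · norm_num
        · exact hki i
    _ = 16 * (32 / 9) ^ (∑ i, k i - 1) *
          ∑ i, (∫ x : Blocks k, ‖x i‖ ∂(iterate ψ μ₀ (n + 1))) ^ 2 := by
        rw [← Finset.mul_sum]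
        congr 1
        refine Finset.sum_congr rfl fun i _ => ?_
        rw [iterate, integral_eval (ν := iterates ψ μ₀ (n + 1)) (f := fun z => ‖z‖) i (by fun_prop)]
    _ ≤ _ := by
        gcongr
        exact sum_sq_integral_norm_le hI

/-- The second moment bound for the first iterate when there are at least two blocks. -/
theorem lintegral_sq_first_iterate_le (h : IsConfining ψ α β) (hk : ∀ i, 0 < k i)
    (hd : 2 ≤ d) (hconv : ConvexOn ℝ Set.univ ψ) (hc : 0 ≤ c) (hp : 0 < p)
    (hg : ∀ x, |ψ x| ≤ c * (1 + euclNorm x ^ p)) (hμ₀ : ∀ i, HasMoment p (μ₀ i)) (n : ℕ) :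
    ∫⁻ x, ENNReal.ofReal (euclNorm x ^ 2) ∂(iterate ψ μ₀ (n + 1)) ≤ ENNReal.ofReal
      (Real.exp ((2 * d + 1) * (entropy ψ (iterate ψ μ₀ (n + 1))).toReal - (d + 1) * α)
        * (∫ x : Blocks k, Real.exp (-(β * euclNorm x + α) / 2)) ^ (2 * d)
        * ∫ x : Blocks k, euclNorm x ^ 2 * Real.exp (-β * ∑ i, ‖x i‖)) := by
  have hmom := h.hasMoment_iterates hc hp hg hμ₀ (n + 1)
  have : ∀ i, IsProbabilityMeasure (iterates ψ μ₀ (n + 1) i) := fun i => (hmom i).1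
  have : IsProbabilityMeasure (iterate ψ μ₀ (n + 1)) := by rw [iterate]; infer_instance
  have hβ := h.pos
  have hfin := h.entropy_iterate_ne_top hc hp hg hμ₀ n
  obtain ⟨hI1, hM⟩ := h.integral_euclNorm_le hfin
  refine (h.lintegral_sq_iterate_le_first_moment hk hd hconv hc hp hg hμ₀ n hI1).trans
    (ENNReal.ofReal_le_ofReal ?_)
  set H := (entropy ψ (iterate ψ μ₀ (n + 1))).toReal
  set K := ∑ i, k i
  have hdK : d ≤ K := by
    calc d = ∑ _i : Fin d, 1 := by simp
      _ ≤ K := Finset.sum_le_sum fun i _ => hk i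
  have hK0 : 0 < K := by omega
  obtain ⟨C, hC, hpol⟩ := exists_integral_pow_mul_exp (k := k) hK0
  set S := C * ((K - 1).factorial / β ^ K)
  have hS0 : 0 < S := by positivity
  have hexp : ∀ t : ℝ, 0 < t → ∫ x : Blocks k, Real.exp (-(t * β * euclNorm x)) =
      (t ^ K)⁻¹ * S := fun t ht => by
    have := hpol 0 (t * β) (by positivity)
    simp only [pow_zero, one_mul, add_zero] at this
    rw [this, mul_pow]; simp only [S, K]; field_simp
  have hS : ∫ x : Blocks k, Real.exp (-(β * euclNorm x)) = S := by
    simpa using hexp 1 one_pos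
  have hSint : Integrable fun x : Blocks k => Real.exp (-(β * euclNorm x)) := by
    refine integrable_of_norm_le_euclNorm (by fun_prop) zero_le_one le_rfl hβ fun x => ?_
    simp
  refine moment_bound_numeric hd hdK hβ hS0 rfl ?_ (integral_nonneg euclNorm_nonneg) ?_ ?_ ?_
  -- Nonnegativity of `u`: `exp (-ψ)` has mass one and lies below `exp (-α - β|x|)`.
  · have h1 : (1 : ℝ) ≤ Real.exp (-α) * S := by
      rw [← h.integral_exp, ← hS, ← integral_const_mul]
      refine integral_mono h.integrable_exp (hSint.const_mul _) fun x => ?_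
      simp only
      rw [← Real.exp_add]
      exact Real.exp_le_exp.2 (by linarith [h.lower x])
    have h2 := Real.log_nonneg h1
    rw [Real.log_mul (Real.exp_pos _).ne' hS0.ne', Real.log_exp] at h2
    have h3 : 0 ≤ H := ENNReal.toReal_nonneg
    linarith
  · refine hM.trans (le_of_eq ?_)
    rw [hexp (3 / 4) (by norm_num), Real.log_mul (by positivity) hS0.ne', ← inv_pow, Real.log_pow]
    rw [show (3 / 4 : ℝ)⁻¹ = 4 / 3 by norm_num]
    ring
  · have h1 := hexp (1 / 2) (by norm_num)
    rw [one_div, inv_pow, inv_inv] at h1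
    rw [← h1, ← integral_const_mul]
    refine integral_congr_ae (Filter.Eventually.of_forall fun x => ?_)
    simp only
    rw [← Real.exp_add]; congr 1; ring
  · have hsd : 0 < √(d : ℝ) := Real.sqrt_pos.2 (by exact_mod_cast (by omega : 0 < d))
    have h1 := hpol 2 (β * √d) (by positivity)
    -- Comparing the sum of block norms with `√d` times the Euclidean norm makes the integral
    -- radial, with the same constant `C` as in `S`.
    have hlow : ∫ x : Blocks k, euclNorm x ^ 2 * Real.exp (-(β * √d * euclNorm x)) ≤
        ∫ x : Blocks k, euclNorm x ^ 2 * Real.exp (-β * ∑ i, ‖x i‖) := by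
      refine integral_mono_of_nonneg (Filter.Eventually.of_forall fun x => by positivity)
        h.integrable_sq_mul_exp (Filter.Eventually.of_forall fun x => ?_)
      refine mul_le_mul_of_nonneg_left (Real.exp_le_exp.2 ?_) (sq_nonneg _)
      have := mul_le_mul_of_nonneg_left (sum_norm_le x) hβ.le
      linarith
    refine le_trans ?_ hlow
    rw [h1]
    have hfac : ((K + 2 - 1).factorial : ℝ) = K * (K + 1) * (K - 1).factorial := by
      rw [show K + 2 - 1 = K - 1 + 1 + 1 by omega, Nat.factorial_succ, Nat.factorial_succ]
      push_cast [Nat.cast_sub hK0]; ring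
    -- Uses `K + 2 ≤ 2 * K`, that is `K ≥ 2`.
    have hpow : √(d : ℝ) ^ (K + 2) ≤ d ^ K := by
      have h1d : 1 ≤ √(d : ℝ) := Real.one_le_sqrt.2 (by exact_mod_cast (by omega : 1 ≤ d))
      calc √(d : ℝ) ^ (K + 2) ≤ √(d : ℝ) ^ (2 * K) := pow_le_pow_right₀ h1d (by omega)
        _ = d ^ K := by rw [pow_mul, Real.sq_sqrt (Nat.cast_nonneg d)]
    rw [hfac, mul_pow, pow_add β]
    calc (K : ℝ) * (K + 1) / (β ^ 2 * d ^ K) * S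
        ≤ K * (K + 1) / (β ^ 2 * √(d : ℝ) ^ (K + 2)) * S := by gcongr
      _ = _ := by simp only [S, K]; field_simp

end IsConfining

end CAVI

/-! ### From moments and entropies to the Wasserstein bounds. -/

namespace CAVI

variable {d : ℕ} {k : Fin d → ℕ}

theorem exists_euclNorm_lower_bound {ψ : Blocks k → ℝ} (hconv : ConvexOn ℝ Set.univ ψ)
    (hρ : ∫⁻ x, ENNReal.ofReal (Real.exp (-ψ x)) = 1) :
    ∃ α β : ℝ, 0 < β ∧ ∀ x, α + β * euclNorm x ≤ ψ x := by
  obtain ⟨a, b, hb, hab⟩ := exists_linear_lower_bound volume hconv (by rw [hρ]; simp)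
  -- Dividing by `d + 1` instead of `d` keeps the slope positive also for `d = 0`.
  refine ⟨a, b / (d + 1), by positivity, fun x => le_trans ?_ (hab x)⟩
  rw [add_le_add_iff_left, div_mul_eq_mul_div, div_le_iff₀ (by positivity)]
  nlinarith [euclNorm_le_mul_norm x, norm_nonneg x]

/-- A closed set of full Lebesgue measure is everything. The bound is needed everywhere since `μ₀`
may charge Lebesgue null sets. -/
theorem forall_of_ae_growth {ψ : Blocks k → ℝ} (hψ : Continuous ψ) {c p : ℝ} (hp : 0 ≤ p)
    (h : ∀ᵐ x, |ψ x| ≤ c * (1 + euclNorm x ^ p)) (x : Blocks k) :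
    |ψ x| ≤ c * (1 + euclNorm x ^ p) := by
  have hclosed : IsClosed {x : Blocks k | |ψ x| ≤ c * (1 + euclNorm x ^ p)} :=
    isClosed_le hψ.abs (continuous_const.mul (continuous_const.add
      (continuous_euclNorm.rpow_const fun _ => Or.inr hp)))
  have hd : Dense {x : Blocks k | |ψ x| ≤ c * (1 + euclNorm x ^ p)} := Measure.dense_of_ae h
  have hx := hd x
  rwa [hclosed.closure_eq] at hx

theorem hasMoment_of_integrable {p : ℝ} (hp : 0 ≤ p)
    {μ : ∀ i, Measure (EuclideanSpace ℝ (Fin (k i)))} (hprob : ∀ i, IsProbabilityMeasure (μ i))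
    (h : Integrable (fun x : Blocks k => euclNorm x ^ p) (Measure.pi μ)) (i : Fin d) :
    HasMoment p (μ i) := by
  refine ⟨hprob i, ?_⟩
  have hm : Measurable fun x : EuclideanSpace ℝ (Fin (k i)) => ‖x‖ ^ p := by fun_prop
  refine ((measurePreserving_eval μ i).integrable_comp hm.aestronglyMeasurable).1 ?_
  refine h.mono' (hm.comp (measurable_pi_apply i)).aestronglyMeasurable
    (Filter.Eventually.of_forall fun x => ?_)
  simp only [Function.comp_apply, Function.eval]
  rw [Real.norm_eq_abs, abs_of_nonneg (by positivity)]
  exact Real.rpow_le_rpow (norm_nonneg _) (norm_apply_le_euclNorm x i) hp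

theorem W2_le_of_moments {μ ν : Measure (Blocks k)} [IsProbabilityMeasure μ]
    [IsProbabilityMeasure ν] {a M : ℝ} (ha : 0 ≤ a) (hM : 4 * M ≤ a ^ 2)
    (hμ : ∫⁻ x, ENNReal.ofReal (euclNorm x ^ 2) ∂μ ≤ ENNReal.ofReal M)
    (hν : ∫⁻ x, ENNReal.ofReal (euclNorm x ^ 2) ∂ν ≤ ENNReal.ofReal M) :
    W2 μ ν ≤ ENNReal.ofReal a := by
  refine W2_le_of_sq_le ha ((W2_sq_le_moments μ ν).trans ?_)
  calc _ ≤ 2 * ENNReal.ofReal M + 2 * ENNReal.ofReal M := by gcongr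
    _ = ENNReal.ofReal (4 * M) := by
      rw [ENNReal.ofReal_mul (by norm_num), ENNReal.ofReal_ofNat, ← add_mul]
      norm_num
    _ ≤ _ := ENNReal.ofReal_le_ofReal hM

/-- Donsker–Varadhan with test function `r|x|²`. The nonnegativity is kept because the final bound
takes a square root. -/
theorem lintegral_sq_le_of_subgaussian {ψ : Blocks k → ℝ} {α β r H : ℝ}
    (h : IsConfining ψ α β) (hr : 0 < r) (hsub : Subgaussian r (target ψ))
    {m : Measure (Blocks k)} [IsProbabilityMeasure m] (hfin : entropy ψ m ≠ ∞)
    (hH : (entropy ψ m).toReal ≤ H) :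
    0 ≤ H + Real.log (∫ x, Real.exp (r * euclNorm x ^ 2) ∂(target ψ)) ∧
    ∫⁻ x, ENNReal.ofReal (euclNorm x ^ 2) ∂m ≤ ENNReal.ofReal
      ((H + Real.log (∫ x, Real.exp (r * euclNorm x ^ 2) ∂(target ψ))) / r) := by
  have := h.isProbabilityMeasure_target
  obtain ⟨h1, h2⟩ := integrable_and_integral_le_klDiv_add_log (μ := m) (ρ := target ψ)
    (φ := fun x => r * euclNorm x ^ 2) (by fun_prop) (C := 0) (fun x => by positivity) hsub hfin
  have h3 : Integrable (fun x => euclNorm x ^ 2) m := by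
    refine (h1.const_mul (1 / r)).congr (Filter.Eventually.of_forall fun x => ?_)
    simp only; field_simp
  have h4 : 0 ≤ ∫ x, r * euclNorm x ^ 2 ∂m := integral_nonneg fun x => by positivity
  have h5 : (entropy ψ m).toReal = (InformationTheory.klDiv m (target ψ)).toReal := rfl
  refine ⟨by linarith, ?_⟩
  rw [← ofReal_integral_eq_lintegral_ofReal h3 (Filter.Eventually.of_forall fun x => sq_nonneg _)]
  refine ENNReal.ofReal_le_ofReal ?_
  rw [integral_const_mul] at h2
  rw [le_div_iff₀ hr]
  linarith

theorem W2_le_of_talagrand {ψ : Blocks k → ℝ} {r H : ℝ} (hr : 0 < r) (hH0 : 0 ≤ H)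
    (hT : Talagrand r (target ψ)) {μ ν : Measure (Blocks k)} [IsProbabilityMeasure μ]
    [IsProbabilityMeasure ν] (hμ : entropy ψ μ ≤ ENNReal.ofReal H)
    (hν : entropy ψ ν ≤ ENNReal.ofReal H) :
    W2 μ ν ≤ ENNReal.ofReal (2 * √(2 * r * H)) := by
  refine W2_le_of_sq_le (by positivity) ((W2_sq_le_of_common μ ν (target ψ)).trans ?_)
  have h1 : ∀ m : Measure (Blocks k), IsProbabilityMeasure m → entropy ψ m ≤ ENNReal.ofReal H →
      W2 m (target ψ) ^ 2 ≤ ENNReal.ofReal (2 * r * H) := fun m hm hle => by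
    rw [ENNReal.ofReal_mul (by positivity)]
    exact (hT m hm).trans (by gcongr; exact hle)
  calc _ ≤ 2 * ENNReal.ofReal (2 * r * H) + 2 * ENNReal.ofReal (2 * r * H) := by
        gcongr
        · exact h1 μ inferInstance hμ
        · exact h1 ν inferInstance hν
    _ = ENNReal.ofReal (4 * (2 * r * H)) := by
      rw [ENNReal.ofReal_mul (p := 4) (by norm_num), ENNReal.ofReal_ofNat, ← add_mul]
      norm_num
    _ = _ := by rw [mul_pow, Real.sq_sqrt (by positivity)]; norm_num

end CAVI

theorem mainTheorem9 {d : ℕ} (k : Fin d → ℕ) (hk : ∀ i, 0 < k i)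
    (ψ : CAVI.Blocks k → ℝ) (hconv : ConvexOn ℝ Set.univ ψ)
    (hρ : ∫⁻ x, ENNReal.ofReal (Real.exp (-ψ x)) = 1)
    (c p : ℝ) (hc : 0 < c) (hp : 1 ≤ p)
    (hgrowth : ∀ᵐ x, |ψ x| ≤ c * (1 + CAVI.euclNorm x ^ p))
    (μ₀ : ∀ i, Measure (EuclideanSpace ℝ (Fin (k i))))
    (hprob : ∀ i, IsProbabilityMeasure (μ₀ i))
    (hmoment : Integrable (fun x : CAVI.Blocks k => CAVI.euclNorm x ^ p) (Measure.pi μ₀))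
    (μstar : Measure (CAVI.Blocks k)) (hstar : CAVI.IsMFVIMinimizer ψ μstar) :
    CAVI.entropy ψ (CAVI.iterate ψ μ₀ 1) < ∞ ∧
    (∃ α β : ℝ, 0 < β ∧ ∀ x, α + β * CAVI.euclNorm x ≤ ψ x) ∧
    (∀ α β : ℝ, 0 < β → (∀ x, α + β * CAVI.euclNorm x ≤ ψ x) →
      CAVI.radius ψ μ₀ μstar ≤ ENNReal.ofReal
        (2 * Real.exp (1 / 2 * (2 * d + 1) * (CAVI.entropy ψ (CAVI.iterate ψ μ₀ 1)).toReal
              - 1 / 2 * (d + 1) * α)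
          * (∫ x : CAVI.Blocks k, Real.exp (-(β * CAVI.euclNorm x + α) / 2)) ^ d
          * √(∫ x : CAVI.Blocks k, CAVI.euclNorm x ^ 2 * Real.exp (-β * ∑ i, ‖x i‖)))) ∧
    (∀ r : ℝ, 0 < r → CAVI.Talagrand r (CAVI.target ψ) →
      CAVI.radius ψ μ₀ μstar ≤ ENNReal.ofReal
        (2 * √(2 * r * (CAVI.entropy ψ (CAVI.iterate ψ μ₀ 1)).toReal))) ∧
    (∀ r : ℝ, 0 < r → CAVI.Subgaussian r (CAVI.target ψ) →
      CAVI.radius ψ μ₀ μstar ≤ ENNReal.ofReal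
        (2 / √r * √((CAVI.entropy ψ (CAVI.iterate ψ μ₀ 1)).toReal
          + Real.log (∫ x, Real.exp (r * CAVI.euclNorm x ^ 2) ∂(CAVI.target ψ))))) := by
  have hcont := CAVI.continuous_of_convexOn_univ hconv
  have hp0 : 0 < p := one_pos.trans_le hp
  have hg := CAVI.forall_of_ae_growth hcont hp0.le hgrowth
  have hμ₀ := CAVI.hasMoment_of_integrable hp0.le hprob hmoment
  have hlow := CAVI.exists_euclNorm_lower_bound hconv hρ
  obtain ⟨α₀, β₀, hβ₀, hαβ₀⟩ := hlow
  have h₀ : CAVI.IsConfining ψ α₀ β₀ := ⟨hcont, hβ₀, hαβ₀, hρ⟩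
  have hfin := h₀.entropy_iterate_ne_top hc.le hp0 hg hμ₀
  have hle := h₀.entropy_iterate_le hc.le hp0 hg hμ₀
  have hfin1 : CAVI.entropy ψ (CAVI.iterate ψ μ₀ 1) ≠ ∞ := hfin 0
  have hpi : ∀ n i, IsProbabilityMeasure (CAVI.iterates ψ μ₀ n i) := fun n i =>
    (h₀.hasMoment_iterates hc.le hp0 hg hμ₀ n i).1
  have hpr : ∀ n, IsProbabilityMeasure (CAVI.iterate ψ μ₀ n) := fun n => by
    rw [CAVI.iterate]; infer_instance
  obtain ⟨⟨m, hm, rfl⟩, hmin⟩ := hstar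
  have hsle : CAVI.entropy ψ (Measure.pi m) ≤ CAVI.entropy ψ (CAVI.iterate ψ μ₀ 1) :=
    hmin ⟨_, hpi 1, rfl⟩
  have hsfin : CAVI.entropy ψ (Measure.pi m) ≠ ∞ := ne_top_of_le_ne_top hfin1 hsle
  have hsle' := ENNReal.toReal_mono hfin1 hsle
  have hle' := fun n => ENNReal.toReal_mono hfin1 (hle n)
  have hradius : ∀ a : ℝ, (∀ n, CAVI.W2 (CAVI.iterate ψ μ₀ (n + 1)) (Measure.pi m) ≤
      ENNReal.ofReal a) → CAVI.radius ψ μ₀ (Measure.pi m) ≤ ENNReal.ofReal a := fun a ha =>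
    iSup₂_le fun n hn => by
      obtain ⟨n, rfl⟩ := Nat.exists_eq_succ_of_ne_zero (Nat.one_le_iff_ne_zero.1 hn)
      exact ha n
  refine ⟨hfin1.lt_top, ⟨α₀, β₀, hβ₀, hαβ₀⟩, fun α β hβ hαβ => ?_, fun r hr hT => ?_,
    fun r hr hsub => ?_⟩
  · have h : CAVI.IsConfining ψ α β := ⟨hcont, hβ, hαβ, hρ⟩
    refine hradius _ fun n => ?_
    have hT0 : 0 ≤ ∫ x : CAVI.Blocks k, CAVI.euclNorm x ^ 2 * Real.exp (-β * ∑ i, ‖x i‖) :=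
      integral_nonneg fun x => by positivity
    refine CAVI.W2_le_of_moments
      (mul_nonneg (mul_nonneg (by positivity) (pow_nonneg h.integral_exp_neg_half_pos.le d))
        (Real.sqrt_nonneg _)) (le_of_eq ?_) ?_
      (h.lintegral_sq_minimizer_le hmin hsfin hsle')
    · rw [mul_pow, Real.sq_sqrt hT0, mul_pow, mul_pow, ← pow_mul, mul_comm d 2,
        ← Real.exp_nat_mul]
      rw [show ∀ x y : ℝ, ((2 : ℕ) : ℝ) * (1 / 2 * (2 * d + 1) * x - 1 / 2 * (d + 1) * y) =
        (2 * d + 1) * x - (d + 1) * y by intro x y; push_cast; ring]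
      ring
    · rcases n with _ | n
      -- With at most one block the state after an update is already `μ_1`, so the general bound
      -- applies. With more blocks the first sweep passes through states of uncontrolled entropy,
      -- and the log-concave argument replaces it.
      · rcases lt_or_ge d 2 with hd | hd
        · refine h.lintegral_sq_iterate_le hc.le hp0 hg hμ₀ 0 (fun i => ?_) le_rfl
          rw [CAVI.partialSweep_of_le ψ μ₀ 0 (by omega)]
          exact ⟨hfin1, le_rfl⟩
        · exact h.lintegral_sq_first_iterate_le hk hd hconv hc.le hp0 hg hμ₀ 0
      · refine h.lintegral_sq_iterate_le hc.le hp0 hg hμ₀ (n + 1) (fun i => ?_) (hle' (n + 1))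
        have h1 := (h.entropy_partialSweep_le hc.le hp0 hg hμ₀ n (i + 1)).trans (hle n)
        exact ⟨ne_top_of_le_ne_top hfin1 h1, ENNReal.toReal_mono hfin1 h1⟩
  · refine hradius _ fun n => ?_
    refine CAVI.W2_le_of_talagrand hr ENNReal.toReal_nonneg hT ?_ ?_
    · rw [ENNReal.ofReal_toReal hfin1]; exact hle n
    · rw [ENNReal.ofReal_toReal hfin1]; exact hsle
  · refine hradius _ fun n => ?_
    obtain ⟨hQ, h1⟩ := CAVI.lintegral_sq_le_of_subgaussian h₀ hr hsub (hfin n) (hle' n)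
    obtain ⟨-, h2⟩ := CAVI.lintegral_sq_le_of_subgaussian h₀ hr hsub hsfin hsle'
    refine CAVI.W2_le_of_moments (by positivity) (le_of_eq ?_) h1 h2
    rw [mul_pow, div_pow, Real.sq_sqrt hr.le, Real.sq_sqrt hQ]
    ring
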